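/- Work in the 2-category $SMC$ whose objects are small symmetric monoidal categories, whose 1-cells are symmetric lax monoidal functors $(F,F^0\colon I\to F(I),F^2_{X,Y}\colon F(X)\otimes F(Y)\to F(X\otimes Y))$, and whose 2-cells are monoidal natural transformations. For $\mathcal A,\mathcal B$ in $SMC$ let $[\mathcal A,\mathcal B]$ be the category $SMC(\mathcal A,\mathcal B)$ with its pointwise symmetric monoidal structure (unit the functor constant at $I_{\mathcal B}$; $(F\Box G)(a)=F(a)\otimes G(a)$). Every 1-cell $F\colon\mathcal A\to[\mathcal B,\mathcal C]$ has a dual $F^*\colon\mathcal B\to[\mathcal A,\mathcal C]$, with $F^*(b)(a)=F(a)(b)$, $(F^*(b))^0=(F^0)_b$, $(F^*(b))^2_{a,a'}=(F^2_{a,a'})_b$, $((F^*)^0)_a=(F(a))^0$ and $((F^*)^2_{b,b'})_a=(F(a))^2_{b,b'}$. For an object $a$ of $\mathcal A$, the evaluation $ev_a\colon[\mathcal A,\mathcal B]\to\mathcal B$ is the value at $a$ of the dual of the identity of $[\mathcal A,\mathcal B]$. The tensor $\mathcal A\otimes\mathcal B$ is the symmetric monoidal category presented as follows. Its objects are the words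 built from the generators $a\otimes b$ ($a\in\mathcal A$, $b\in\mathcal B$) with a constant $I$ and a binary operation $\otimes$. Its generating arrows, besides the canonical ones, are $f\otimes b\colon a\otimes b\to a'\otimes b$ for $f\colon a\to a'$ in $\mathcal A$, $a\otimes g\colon a\otimes b\to a\otimes b'$ for $g\colon b\to b'$ in $\mathcal B$, and $$\alpha_b\colon I\to I_{\mathcal A}\otimes b,\qquad \beta_a\colon I\to a\otimes I_{\mathcal B},\qquad \gamma_{a,a',b}\colon(a\otimes b)\otimes(a'\otimes b)\to(a\otimes a')\otimes b,\qquad \delta_{a,b,b'}\colon(a\otimes b)\otimes(a\otimes b')\to a\otimes(b\otimes b').$$ Its relations, besides the axioms of a symmetric monoidal category, are exactly those stating that the assignments $\eta(a)\colon b\mapsto a\otimes b,\ g\mapsto a\otimes g$ with $\eta(a)^0=\beta_a$, $\eta(a)^2_{b,b'}=\delta_{a,b,b'}$; $\eta(f)_b=f\otimes b$; $(\eta^0)_b=\alpha_b$; $(\eta^2_{a,a'})_b=\gamma_{a,a',b}$ define a symmetric monoidal functor $\eta\colon\mathcal A\to[\mathcal B,\mathcal A\otimes\mathcal B]$ (that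 is: each $\eta(a)$ is a symmetric monoidal functor, each $\eta(f)$, $\eta^0$ and $\eta^2_{a,a'}$ is a monoidal natural transformation, and $\eta$ is a symmetric monoidal functor). For every 1-cell $F\colon\mathcal A\to[\mathcal B,\mathcal C]$ let $En(F)\colon\mathcal A\otimes\mathcal B\to\mathcal C$ be the corresponding strict symmetric monoidal functor, with $En(F)(a\otimes b)=F(a)(b)$, $f\otimes b\mapsto F(f)_b$, $a\otimes g\mapsto F(a)(g)$, $\alpha_b\mapsto(F^0)_b$, $\beta_a\mapsto(F(a))^0$, $\gamma_{a,a',b}\mapsto(F^2_{a,a'})_b$ and $\delta_{a,b,b'}\mapsto(F(a))^2_{b,b'}$. Let $unc$ be the free symmetric monoidal category on one object $\star$ (objects: words built from $\star$ with $I$ and $\otimes$; arrows: classes of formal canonical arrows). For $\mathcal A$ in $SMC$ let $v\colon unc\to[\mathcal A,\mathcal A]$ be the strict symmetric monoidal functor with $v(\star)=1_{\mathcal A}$, and put $$R=En(v^*)\colon\mathcal A\otimes unc\to\mathcal A,\qquad R'=\bigl(\mathcal A\xrightarrow{\ \eta\ }[unc,\mathcal A\otimes unc]\xrightarrow{\ ev_\star\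 }\mathcal A\otimes unc\bigr).$$ Then for every small symmetric monoidal category $\mathcal A$: 1. $R\circ R'=1_{\mathcal A}$, as an equality of 1-cells of $SMC$ (of functors together with their monoidal structures); 2. there exist a 1-cell $F\colon\mathcal A\otimes unc\to\mathcal A\otimes unc$ of $SMC$ and 2-cells $F\to 1_{\mathcal A\otimes unc}$ and $F\to R'\circ R$ of $SMC$; so $R$ and $R'$ are inverse to each other up to the zigzag of 2-cells $1\leftarrow F\to R'\circ R$. -/

import Mathlib

universe u

open CategoryTheory MonoidalCategory Functor.LaxMonoidal

namespace SMC

/-! ### The 2-category of small symmetric monoidal categories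

Objects are small symmetric monoidal categories, 1-cells are the symmetric (lax) monoidal
functors `LaxBraidedFunctor A B` and 2-cells are the morphisms of `LaxBraidedFunctor A B`, that is
the monoidal natural transformations. -/

section TwoCategory

variable {A B C : Type u}
  [SmallCategory A] [MonoidalCategory A] [SymmetricCategory A]
  [SmallCategory B] [MonoidalCategory B] [SymmetricCategory B]
  [SmallCategory C] [MonoidalCategory C] [SymmetricCategory C]

variable (A) in
/-- The identity 1-cell. -/
def idFun : LaxBraidedFunctor A A := LaxBraidedFunctor.of (𝟭 A)

/-- The composite 1-cell `G ∘ F`, with structure arrows `G(F⁰) ∘ G⁰` and `G(F²) ∘ G²`. -/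
def compFun (F : LaxBraidedFunctor A B) (G : LaxBraidedFunctor B C) : LaxBraidedFunctor A C :=
  LaxBraidedFunctor.of (F.toFunctor ⋙ G.toFunctor)

/-- The component of a 2-cell at an object. -/
def app {F G : LaxBraidedFunctor A B} (σ : F ⟶ G) (a : A) : F.obj a ⟶ G.obj a :=
  σ.hom.hom.app a

/-- A monoidal natural transformation from its components. -/
def mkHom {F G : LaxBraidedFunctor A B} (s : ∀ a, F.obj a ⟶ G.obj a)
    (nat : ∀ {a a' : A} (f : a ⟶ a'), F.map f ≫ s a' = s a ≫ G.map f)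
    (unit : ε F.toFunctor ≫ s (𝟙_ A) = ε G.toFunctor)
    (tens : ∀ a a', μ F.toFunctor a a' ≫ s (a ⊗ a') = (s a ⊗ₘ s a') ≫ μ G.toFunctor a a') :
    F ⟶ G :=
  @LaxBraidedFunctor.homMk A _ _ _ B _ _ _ F G { app := s, naturality := fun _ _ f => nat f }
    { unit := unit, tensor := tens }

@[simp] lemma app_mkHom {F G : LaxBraidedFunctor A B} (s : ∀ a, F.obj a ⟶ G.obj a)
    (nat : ∀ {a a' : A} (f : a ⟶ a'), F.map f ≫ s a' = s a ≫ G.map f)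
    (unit : ε F.toFunctor ≫ s (𝟙_ A) = ε G.toFunctor)
    (tens : ∀ a a', μ F.toFunctor a a' ≫ s (a ⊗ a') = (s a ⊗ₘ s a') ≫ μ G.toFunctor a a')
    (a : A) : app (mkHom s nat unit tens) a = s a := rfl

@[simp] lemma app_id (F : LaxBraidedFunctor A B) (a : A) : app (𝟙 F) a = 𝟙 (F.obj a) := rfl

@[simp] lemma app_comp {F G H : LaxBraidedFunctor A B} (σ : F ⟶ G) (τ : G ⟶ H) (a : A) :
    app (σ ≫ τ) a = app σ a ≫ app τ a := rfl

lemma hom_ext {F G : LaxBraidedFunctor A B} {σ τ : F ⟶ G} (h : ∀ a, app σ a = app τ a) :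
    σ = τ := by
  apply LaxBraidedFunctor.hom_ext
  ext a
  exact h a

lemma app_nat {F G : LaxBraidedFunctor A B} (σ : F ⟶ G) {a a' : A} (f : a ⟶ a') :
    F.map f ≫ app σ a' = app σ a ≫ G.map f := σ.hom.hom.naturality f

lemma app_unit {F G : LaxBraidedFunctor A B} (σ : F ⟶ G) :
    ε F.toFunctor ≫ app σ (𝟙_ A) = ε G.toFunctor := σ.hom.isMonoidal.unit

lemma app_tens {F G : LaxBraidedFunctor A B} (σ : F ⟶ G) (a a' : A) :
    μ F.toFunctor a a' ≫ app σ (a ⊗ a') = (app σ a ⊗ₘ app σ a') ≫ μ G.toFunctor a a' :=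
  σ.hom.isMonoidal.tensor a a'

end TwoCategory

/-! ### The internal hom `[A, B]` -/

section InternalHom

lemma unit_shift {B : Type u} [SmallCategory B] [MonoidalCategory B] {Y Z : B}
    {p : 𝟙_ B ⊗ 𝟙_ B ⟶ Y} {c : Y ⟶ Z} {q : 𝟙_ B ⟶ Z}
    (h : p ≫ c = (λ_ (𝟙_ B)).hom ≫ q) : ((λ_ (𝟙_ B)).inv ≫ p) ≫ c = q := by
  rw [Category.assoc, h, Iso.inv_hom_id_assoc]

variable {A B : Type u}
  [SmallCategory A] [MonoidalCategory A] [SymmetricCategory A]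
  [SmallCategory B] [MonoidalCategory B] [SymmetricCategory B]

lemma tensorμ_braid_inner (X₁ X₂ Y₁ Y₂ : B) :
    tensorμ X₁ X₂ Y₁ Y₂ ≫ (β_ (X₁ ⊗ Y₁) (X₂ ⊗ Y₂)).hom =
      ((β_ X₁ X₂).hom ⊗ₘ (β_ Y₁ Y₂).hom) ≫ tensorμ X₂ X₁ Y₂ Y₁ := by
  simp [tensorμ, SymmetricCategory.braiding_swap_eq_inv_braiding Y₁ X₂, MonoidalCategory.tensorHom_def]

lemma tensorμ_tensorμ (X₁ X₂ Y₁ Y₂ : B) :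
    tensorμ X₁ X₂ Y₁ Y₂ ≫ tensorμ X₁ Y₁ X₂ Y₂ = 𝟙 _ := by
  have : tensorμ X₁ Y₁ X₂ Y₂ = tensorδ X₁ X₂ Y₁ Y₂ := by
    simp [tensorμ, tensorδ, SymmetricCategory.braiding_swap_eq_inv_braiding X₂ Y₁]
  rw [this, tensorμ_tensorδ]

lemma tensorμ_braid_outer (X₁ X₂ Y₁ Y₂ : B) :
    tensorμ X₁ X₂ Y₁ Y₂ ≫ ((β_ X₁ Y₁).hom ⊗ₘ (β_ X₂ Y₂).hom) =
      (β_ (X₁ ⊗ X₂) (Y₁ ⊗ Y₂)).hom ≫ tensorμ Y₁ Y₂ X₁ X₂ := by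
  have h := tensorμ_braid_inner X₁ Y₁ X₂ Y₂
  calc _ = tensorμ X₁ X₂ Y₁ Y₂ ≫ (((β_ X₁ Y₁).hom ⊗ₘ (β_ X₂ Y₂).hom) ≫ tensorμ Y₁ X₁ Y₂ X₂) ≫
        tensorμ Y₁ Y₂ X₁ X₂ := by
          rw [Category.assoc, tensorμ_tensorμ, Category.comp_id]
    _ = _ := by rw [← h, Category.assoc, ← Category.assoc, tensorμ_tensorμ, Category.id_comp]

lemma tensorμ_shift {X₁ X₂ Y₁ Y₂ Y Z : B} {p : (X₁ ⊗ X₂) ⊗ (Y₁ ⊗ Y₂) ⟶ Y} {c : Y ⟶ Z}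
    {q : (X₁ ⊗ Y₁) ⊗ (X₂ ⊗ Y₂) ⟶ Z} (h : p ≫ c = tensorμ X₁ X₂ Y₁ Y₂ ≫ q) :
    (tensorμ X₁ Y₁ X₂ Y₂ ≫ p) ≫ c = q := by
  rw [Category.assoc, h, ← Category.assoc, tensorμ_tensorμ, Category.id_comp]

/-- The unit of `[A, B]`: the constant functor at the unit of `B`. -/
def boxUnit : LaxBraidedFunctor A B where
  toFunctor := (Functor.const A).obj (𝟙_ B)
  laxBraided :=
    { ε := 𝟙 _
      μ := fun _ _ => (λ_ (𝟙_ B)).hom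
      associativity := by intros; simp [unitors_equal]
      left_unitality := by intros; simp
      right_unitality := by intros; simp [unitors_equal]
      braided := by intros; simp [← unitors_equal] }

def boxFunctor (F G : LaxBraidedFunctor A B) : A ⥤ B where
  obj a := F.obj a ⊗ G.obj a
  map f := F.map f ⊗ₘ G.map f
  map_comp f g := by simp

def box (F G : LaxBraidedFunctor A B) : LaxBraidedFunctor A B where
  toFunctor := boxFunctor F G
  laxBraided :=
    { ε := (λ_ (𝟙_ B)).inv ≫ (ε F.toFunctor ⊗ₘ ε G.toFunctor)
      μ := fun a b => tensorμ (F.obj a) (G.obj a) (F.obj b) (G.obj b) ≫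
        (μ F.toFunctor a b ⊗ₘ μ G.toFunctor a b)
      μ_natural_left := fun f b => by
        dsimp only [boxFunctor]
        rw [tensorμ_natural_left_assoc, tensorHom_comp_tensorHom, Category.assoc,
          tensorHom_comp_tensorHom, μ_natural_left, μ_natural_left]
      μ_natural_right := fun f b => by
        dsimp only [boxFunctor]
        rw [tensorμ_natural_right_assoc, tensorHom_comp_tensorHom, Category.assoc,
          tensorHom_comp_tensorHom, μ_natural_right, μ_natural_right]
      associativity := fun a b c => by
        dsimp only [boxFunctor]
        simp only [comp_whiskerRight, MonoidalCategory.whiskerLeft_comp, Category.assoc]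
        rw [tensorμ_natural_left_assoc, tensorμ_natural_right_assoc,
          ← tensor_associativity_assoc]
        simp only [tensorHom_comp_tensorHom, associativity]
      left_unitality := fun a => by
        dsimp only [boxFunctor]
        simp only [comp_whiskerRight, Category.assoc]
        rw [tensorμ_natural_left_assoc, tensor_left_unitality]
        simp only [tensorHom_comp_tensorHom, left_unitality]
      right_unitality := fun a => by
        dsimp only [boxFunctor]
        simp only [MonoidalCategory.whiskerLeft_comp, Category.assoc]
        rw [tensorμ_natural_right_assoc, tensor_right_unitality]
        simp only [tensorHom_comp_tensorHom, right_unitality]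
      braided := fun a b => by
        dsimp only [boxFunctor]
        rw [← Category.assoc, ← tensorμ_braid_outer, Category.assoc, Category.assoc]
        simp only [tensorHom_comp_tensorHom, Functor.LaxBraided.braided] }

/-- The tensor `σ □ τ` of 2-cells, computed pointwise. -/
def boxHom {F F' G G' : LaxBraidedFunctor A B} (σ : F ⟶ F') (τ : G ⟶ G') :
    box F G ⟶ box F' G' :=
  mkHom (fun a => app σ a ⊗ₘ app τ a)
    (fun {a a'} f => by
      change (F.map f ⊗ₘ G.map f) ≫ (app σ a' ⊗ₘ app τ a') =
        (app σ a ⊗ₘ app τ a) ≫ (F'.map f ⊗ₘ G'.map f)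
      simp only [tensorHom_comp_tensorHom, app_nat])
    (by
      change ((λ_ (𝟙_ B)).inv ≫ (ε F.toFunctor ⊗ₘ ε G.toFunctor)) ≫
        (app σ (𝟙_ A) ⊗ₘ app τ (𝟙_ A)) =
        (λ_ (𝟙_ B)).inv ≫ (ε F'.toFunctor ⊗ₘ ε G'.toFunctor)
      simp only [Category.assoc, tensorHom_comp_tensorHom, app_unit])
    (fun a a' => by
      change (tensorμ (F.obj a) (G.obj a) (F.obj a') (G.obj a') ≫
        (μ F.toFunctor a a' ⊗ₘ μ G.toFunctor a a')) ≫
          (app σ (a ⊗ a') ⊗ₘ app τ (a ⊗ a')) =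
        ((app σ a ⊗ₘ app τ a) ⊗ₘ app σ a' ⊗ₘ app τ a') ≫
          tensorμ (F'.obj a) (G'.obj a) (F'.obj a') (G'.obj a') ≫
        (μ F'.toFunctor a a' ⊗ₘ μ G'.toFunctor a a')
      rw [tensorμ_natural_assoc]
      simp only [Category.assoc, tensorHom_comp_tensorHom, app_tens])

/-- A 2-cell with invertible components is invertible. -/
def mkIso {F G : LaxBraidedFunctor A B} (s : ∀ a, F.obj a ≅ G.obj a)
    (nat : ∀ {a a' : A} (f : a ⟶ a'), F.map f ≫ (s a').hom = (s a).hom ≫ G.map f)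
    (unit : ε F.toFunctor ≫ (s (𝟙_ A)).hom = ε G.toFunctor)
    (tens : ∀ a a', μ F.toFunctor a a' ≫ (s (a ⊗ a')).hom =
      ((s a).hom ⊗ₘ (s a').hom) ≫ μ G.toFunctor a a') : F ≅ G where
  hom := mkHom (fun a => (s a).hom) nat unit tens
  inv := mkHom (fun a => (s a).inv)
    (fun f => by rw [Iso.comp_inv_eq, Category.assoc, nat, Iso.inv_hom_id_assoc])
    (by rw [Iso.comp_inv_eq, unit])
    (fun a a' => by
      rw [Iso.comp_inv_eq, Category.assoc, tens, tensorHom_comp_tensorHom_assoc,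
        Iso.inv_hom_id, Iso.inv_hom_id, id_tensorHom_id, Category.id_comp])
  hom_inv_id := hom_ext fun a => by simp
  inv_hom_id := hom_ext fun a => by simp

/-- The associator of `[A, B]`. -/
def boxAssoc (F G H : LaxBraidedFunctor A B) : box (box F G) H ≅ box F (box G H) :=
  mkIso (fun a => α_ (F.obj a) (G.obj a) (H.obj a))
    (fun f => associator_naturality _ _ _)
    (by
      change ((λ_ (𝟙_ B)).inv ≫ (((λ_ (𝟙_ B)).inv ≫ (ε F.toFunctor ⊗ₘ ε G.toFunctor)) ⊗ₘ
          ε H.toFunctor)) ≫ (α_ (F.obj (𝟙_ A)) (G.obj (𝟙_ A)) (H.obj (𝟙_ A))).hom =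
        (λ_ (𝟙_ B)).inv ≫ (ε F.toFunctor ⊗ₘ ((λ_ (𝟙_ B)).inv ≫
          (ε G.toFunctor ⊗ₘ ε H.toFunctor)))
      rw [← Category.id_comp (ε H.toFunctor), ← tensorHom_comp_tensorHom,
        ← Category.id_comp (ε F.toFunctor), ← tensorHom_comp_tensorHom]
      simp [unitors_inv_equal])
    (fun a a' => by
      change (tensorμ (F.obj a ⊗ G.obj a) (H.obj a) (F.obj a' ⊗ G.obj a') (H.obj a') ≫
          ((tensorμ (F.obj a) (G.obj a) (F.obj a') (G.obj a') ≫
            (μ F.toFunctor a a' ⊗ₘ μ G.toFunctor a a')) ⊗ₘ μ H.toFunctor a a')) ≫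
          (α_ (F.obj (a ⊗ a')) (G.obj (a ⊗ a')) (H.obj (a ⊗ a'))).hom =
        ((α_ (F.obj a) (G.obj a) (H.obj a)).hom ⊗ₘ (α_ (F.obj a') (G.obj a') (H.obj a')).hom) ≫
          tensorμ (F.obj a) (G.obj a ⊗ H.obj a) (F.obj a') (G.obj a' ⊗ H.obj a') ≫
            (μ F.toFunctor a a' ⊗ₘ (tensorμ (G.obj a) (H.obj a) (G.obj a') (H.obj a') ≫
              (μ G.toFunctor a a' ⊗ₘ μ H.toFunctor a a')))
      have h := associator_monoidal (F.obj a) (G.obj a) (H.obj a) (F.obj a') (G.obj a') (H.obj a')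
      rw [← Category.id_comp (μ H.toFunctor a a'), ← tensorHom_comp_tensorHom,
        ← Category.id_comp (μ F.toFunctor a a'), ← tensorHom_comp_tensorHom]
      simp only [Category.id_comp, Category.assoc, associator_naturality, tensorHom_id,
        id_tensorHom]
      simp only [← Category.assoc] at h ⊢
      rw [← h])

/-- The left unitor of `[A, B]`. -/
def boxLeftUnitor (F : LaxBraidedFunctor A B) : box boxUnit F ≅ F :=
  mkIso (fun a => λ_ (F.obj a))
    (fun {a a'} f => by
      change (𝟙 (𝟙_ B) ⊗ₘ F.map f) ≫ (λ_ (F.obj a')).hom = (λ_ (F.obj a)).hom ≫ F.map f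
      simp)
    (by
      change ((λ_ (𝟙_ B)).inv ≫ (𝟙 (𝟙_ B) ⊗ₘ ε F.toFunctor)) ≫ (λ_ (F.obj (𝟙_ A))).hom =
        ε F.toFunctor
      simp only [id_tensorHom, Category.assoc, leftUnitor_naturality, Iso.inv_hom_id_assoc])
    (fun a a' => by
      change (tensorμ (𝟙_ B) (F.obj a) (𝟙_ B) (F.obj a') ≫
          ((λ_ (𝟙_ B)).hom ⊗ₘ μ F.toFunctor a a')) ≫ (λ_ (F.obj (a ⊗ a'))).hom =
        ((λ_ (F.obj a)).hom ⊗ₘ (λ_ (F.obj a')).hom) ≫ μ F.toFunctor a a'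
      rw [leftUnitor_monoidal]
      simp only [MonoidalCategory.tensorHom_def, Category.assoc, leftUnitor_naturality])

/-- The right unitor of `[A, B]`. -/
def boxRightUnitor (F : LaxBraidedFunctor A B) : box F boxUnit ≅ F :=
  mkIso (fun a => ρ_ (F.obj a))
    (fun {a a'} f => by
      change (F.map f ⊗ₘ 𝟙 (𝟙_ B)) ≫ (ρ_ (F.obj a')).hom = (ρ_ (F.obj a)).hom ≫ F.map f
      simp)
    (by
      change ((λ_ (𝟙_ B)).inv ≫ (ε F.toFunctor ⊗ₘ 𝟙 (𝟙_ B))) ≫ (ρ_ (F.obj (𝟙_ A))).hom =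
        ε F.toFunctor
      simp only [tensorHom_id, Category.assoc, rightUnitor_naturality, unitors_inv_equal,
        Iso.inv_hom_id_assoc])
    (fun a a' => by
      change (tensorμ (F.obj a) (𝟙_ B) (F.obj a') (𝟙_ B) ≫
          (μ F.toFunctor a a' ⊗ₘ (λ_ (𝟙_ B)).hom)) ≫ (ρ_ (F.obj (a ⊗ a'))).hom =
        ((ρ_ (F.obj a)).hom ⊗ₘ (ρ_ (F.obj a')).hom) ≫ μ F.toFunctor a a'
      rw [rightUnitor_monoidal]
      simp only [MonoidalCategory.tensorHom_def', Category.assoc, rightUnitor_naturality])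

/-- The symmetry of `[A, B]`. -/
def boxBraiding (F G : LaxBraidedFunctor A B) : box F G ≅ box G F :=
  mkIso (fun a => β_ (F.obj a) (G.obj a))
    (fun f => BraidedCategory.braiding_naturality _ _)
    (by
      change ((λ_ (𝟙_ B)).inv ≫ (ε F.toFunctor ⊗ₘ ε G.toFunctor)) ≫
          (β_ (F.obj (𝟙_ A)) (G.obj (𝟙_ A))).hom =
        (λ_ (𝟙_ B)).inv ≫ (ε G.toFunctor ⊗ₘ ε F.toFunctor)
      rw [Category.assoc, BraidedCategory.braiding_naturality]
      simp [unitors_inv_equal])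
    (fun a a' => by
      change (tensorμ (F.obj a) (G.obj a) (F.obj a') (G.obj a') ≫
          (μ F.toFunctor a a' ⊗ₘ μ G.toFunctor a a')) ≫
          (β_ (F.obj (a ⊗ a')) (G.obj (a ⊗ a'))).hom =
        ((β_ (F.obj a) (G.obj a)).hom ⊗ₘ (β_ (F.obj a') (G.obj a')).hom) ≫
          tensorμ (G.obj a) (F.obj a) (G.obj a') (F.obj a') ≫
            (μ G.toFunctor a a' ⊗ₘ μ F.toFunctor a a')
      rw [Category.assoc, BraidedCategory.braiding_naturality, ← Category.assoc,
        tensorμ_braid_inner, Category.assoc])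

/-- The monoidal structure of the internal hom `[A, B]`. -/
instance homMonoidal : MonoidalCategory (LaxBraidedFunctor A B) where
  tensorObj := box
  tensorUnit := boxUnit
  tensorHom := boxHom
  whiskerLeft F _ _ τ := boxHom (𝟙 F) τ
  whiskerRight σ G := boxHom σ (𝟙 G)
  associator := boxAssoc
  leftUnitor := boxLeftUnitor
  rightUnitor := boxRightUnitor
  tensorHom_def {F F' G G'} σ τ := hom_ext fun a => by
    change app σ a ⊗ₘ app τ a = (app σ a ⊗ₘ 𝟙 (G.obj a)) ≫ (𝟙 (F'.obj a) ⊗ₘ app τ a)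
    simp [MonoidalCategory.tensorHom_def]
  id_tensorHom_id _ _ := hom_ext fun _ => id_tensorHom_id _ _
  tensorHom_comp_tensorHom _ _ _ _ := hom_ext fun _ => tensorHom_comp_tensorHom _ _ _ _
  whiskerLeft_id _ _ := hom_ext fun _ => id_tensorHom_id _ _
  id_whiskerRight _ _ := hom_ext fun _ => id_tensorHom_id _ _
  associator_naturality _ _ _ := hom_ext fun _ => associator_naturality _ _ _
  leftUnitor_naturality {F G} σ := hom_ext fun a => by
    change (𝟙 (𝟙_ B) ⊗ₘ app σ a) ≫ (λ_ (G.obj a)).hom = (λ_ (F.obj a)).hom ≫ app σ a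
    simp
  rightUnitor_naturality {F G} σ := hom_ext fun a => by
    change (app σ a ⊗ₘ 𝟙 (𝟙_ B)) ≫ (ρ_ (G.obj a)).hom = (ρ_ (F.obj a)).hom ≫ app σ a
    simp
  pentagon F G H K := hom_ext fun a => by
    change ((α_ (F.obj a) (G.obj a) (H.obj a)).hom ⊗ₘ 𝟙 (K.obj a)) ≫
        (α_ (F.obj a) (G.obj a ⊗ H.obj a) (K.obj a)).hom ≫
          (𝟙 (F.obj a) ⊗ₘ (α_ (G.obj a) (H.obj a) (K.obj a)).hom) =
      (α_ (F.obj a ⊗ G.obj a) (H.obj a) (K.obj a)).hom ≫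
        (α_ (F.obj a) (G.obj a) (H.obj a ⊗ K.obj a)).hom
    rw [tensorHom_id, id_tensorHom, pentagon]
  triangle F G := hom_ext fun a => by
    change (α_ (F.obj a) (𝟙_ B) (G.obj a)).hom ≫ (𝟙 (F.obj a) ⊗ₘ (λ_ (G.obj a)).hom) =
      (ρ_ (F.obj a)).hom ⊗ₘ 𝟙 (G.obj a)
    rw [tensorHom_id, id_tensorHom, triangle]

/-- The internal hom `[A, B]` is symmetric monoidal, with canonical isomorphisms
computed pointwise. -/
instance homSymmetric : SymmetricCategory (LaxBraidedFunctor A B) where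
  braiding := boxBraiding
  braiding_naturality_left {F G} σ H := hom_ext fun a => by
    change (app σ a ⊗ₘ 𝟙 (H.obj a)) ≫ (β_ (G.obj a) (H.obj a)).hom =
      (β_ (F.obj a) (H.obj a)).hom ≫ (𝟙 (H.obj a) ⊗ₘ app σ a)
    exact BraidedCategory.braiding_naturality _ _
  braiding_naturality_right H F G σ := hom_ext fun a => by
    change (𝟙 (H.obj a) ⊗ₘ app σ a) ≫ (β_ (H.obj a) (G.obj a)).hom =
      (β_ (H.obj a) (F.obj a)).hom ≫ (app σ a ⊗ₘ 𝟙 (H.obj a))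
    exact BraidedCategory.braiding_naturality _ _
  hexagon_forward F G H := hom_ext fun a => by
    change (α_ (F.obj a) (G.obj a) (H.obj a)).hom ≫ (β_ (F.obj a) (G.obj a ⊗ H.obj a)).hom ≫
        (α_ (G.obj a) (H.obj a) (F.obj a)).hom =
      ((β_ (F.obj a) (G.obj a)).hom ⊗ₘ 𝟙 (H.obj a)) ≫ (α_ (G.obj a) (F.obj a) (H.obj a)).hom ≫
        (𝟙 (G.obj a) ⊗ₘ (β_ (F.obj a) (H.obj a)).hom)
    rw [tensorHom_id, id_tensorHom, BraidedCategory.hexagon_forward]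
  hexagon_reverse F G H := hom_ext fun a => by
    change (α_ (F.obj a) (G.obj a) (H.obj a)).inv ≫ (β_ (F.obj a ⊗ G.obj a) (H.obj a)).hom ≫
        (α_ (H.obj a) (F.obj a) (G.obj a)).inv =
      (𝟙 (F.obj a) ⊗ₘ (β_ (G.obj a) (H.obj a)).hom) ≫ (α_ (F.obj a) (H.obj a) (G.obj a)).inv ≫
        ((β_ (F.obj a) (H.obj a)).hom ⊗ₘ 𝟙 (G.obj a))
    rw [tensorHom_id, id_tensorHom, BraidedCategory.hexagon_reverse]
  symmetry _ _ := hom_ext fun _ => SymmetricCategory.symmetry _ _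

lemma app_whiskerRight {F G : LaxBraidedFunctor A B} (σ : F ⟶ G) (H : LaxBraidedFunctor A B)
    (a : A) : app (σ ▷ H) a = app σ a ▷ H.obj a := tensorHom_id _ _

lemma app_whiskerLeft (H : LaxBraidedFunctor A B) {F G : LaxBraidedFunctor A B} (σ : F ⟶ G)
    (a : A) : app (H ◁ σ) a = H.obj a ◁ app σ a := id_tensorHom _ _

end InternalHom

/-! ### Symmetric monoidal functors `F : A → [B, C]` in components, and their duals -/

section Dual

variable {A B C : Type u}
  [SmallCategory A] [MonoidalCategory A] [SymmetricCategory A]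
  [SmallCategory B] [MonoidalCategory B] [SymmetricCategory B]
  [SmallCategory C] [MonoidalCategory C] [SymmetricCategory C]
  (F : LaxBraidedFunctor A (LaxBraidedFunctor B C))

/-- The component `(F⁰)_b`. -/
def unitAt (b : B) : 𝟙_ C ⟶ (F.obj (𝟙_ A)).obj b := app (ε F.toFunctor) b

/-- The component `(F²_{a,a'})_b`. -/
def multAt (a a' : A) (b : B) :
    (F.obj a).obj b ⊗ (F.obj a').obj b ⟶ (F.obj (a ⊗ a')).obj b := app (μ F.toFunctor a a') b

lemma unitAt_nat {b b' : B} (g : b ⟶ b') :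
    unitAt F b ≫ (F.obj (𝟙_ A)).map g = unitAt F b' :=
  (app_nat (ε F.toFunctor) g).symm.trans (Category.id_comp _)

lemma unitAt_unit : unitAt F (𝟙_ B) = ε (F.obj (𝟙_ A)).toFunctor :=
  (Category.id_comp _).symm.trans (app_unit (ε F.toFunctor))

lemma unitAt_tens (b b' : B) :
    (unitAt F b ⊗ₘ unitAt F b') ≫ μ (F.obj (𝟙_ A)).toFunctor b b' =
      (λ_ (𝟙_ C)).hom ≫ unitAt F (b ⊗ b') := (app_tens (ε F.toFunctor) b b').symm

lemma multAt_nat (a a' : A) {b b' : B} (g : b ⟶ b') :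
    multAt F a a' b ≫ (F.obj (a ⊗ a')).map g =
      ((F.obj a).map g ⊗ₘ (F.obj a').map g) ≫ multAt F a a' b' :=
  (app_nat (μ F.toFunctor a a') g).symm

lemma multAt_unit (a a' : A) :
    (ε (F.obj a).toFunctor ⊗ₘ ε (F.obj a').toFunctor) ≫ multAt F a a' (𝟙_ B) =
      (λ_ (𝟙_ C)).hom ≫ ε (F.obj (a ⊗ a')).toFunctor := by
  have h : ((λ_ (𝟙_ C)).inv ≫ (ε (F.obj a).toFunctor ⊗ₘ ε (F.obj a').toFunctor)) ≫
      multAt F a a' (𝟙_ B) = ε (F.obj (a ⊗ a')).toFunctor := app_unit (μ F.toFunctor a a')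
  rw [← h, Category.assoc, Iso.hom_inv_id_assoc]

lemma multAt_tens (a a' : A) (b b' : B) :
    (μ (F.obj a).toFunctor b b' ⊗ₘ μ (F.obj a').toFunctor b b') ≫ multAt F a a' (b ⊗ b') =
      tensorμ ((F.obj a).obj b) ((F.obj a).obj b') ((F.obj a').obj b) ((F.obj a').obj b') ≫
        (multAt F a a' b ⊗ₘ multAt F a a' b') ≫ μ (F.obj (a ⊗ a')).toFunctor b b' := by
  have h : (tensorμ ((F.obj a).obj b) ((F.obj a').obj b) ((F.obj a).obj b') ((F.obj a').obj b') ≫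
      (μ (F.obj a).toFunctor b b' ⊗ₘ μ (F.obj a').toFunctor b b')) ≫ multAt F a a' (b ⊗ b') =
      (multAt F a a' b ⊗ₘ multAt F a a' b') ≫ μ (F.obj (a ⊗ a')).toFunctor b b' :=
    app_tens (μ F.toFunctor a a') b b'
  rw [← h, Category.assoc, ← Category.assoc, tensorμ_tensorμ, Category.id_comp]

lemma multAt_nat_left {a₁ a₂ : A} (f : a₁ ⟶ a₂) (a' : A) (b : B) :
    app (F.map f) b ▷ (F.obj a').obj b ≫ multAt F a₂ a' b =
      multAt F a₁ a' b ≫ app (F.map (f ▷ a')) b := by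
  have h := congrArg (fun σ => app σ b) (μ_natural_left F.toFunctor f a')
  simp only [app_comp, app_whiskerRight] at h
  exact h

lemma multAt_nat_right (a' : A) {a₁ a₂ : A} (f : a₁ ⟶ a₂) (b : B) :
    (F.obj a').obj b ◁ app (F.map f) b ≫ multAt F a' a₂ b =
      multAt F a' a₁ b ≫ app (F.map (a' ◁ f)) b := by
  have h := congrArg (fun σ => app σ b) (μ_natural_right F.toFunctor a' f)
  simp only [app_comp, app_whiskerLeft] at h
  exact h

lemma multAt_assoc (a a' a'' : A) (b : B) :
    multAt F a a' b ▷ (F.obj a'').obj b ≫ multAt F (a ⊗ a') a'' b ≫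
        app (F.map (α_ a a' a'').hom) b =
      (α_ ((F.obj a).obj b) ((F.obj a').obj b) ((F.obj a'').obj b)).hom ≫
        (F.obj a).obj b ◁ multAt F a' a'' b ≫ multAt F a (a' ⊗ a'') b := by
  have h := congrArg (fun σ => app σ b) (associativity F.toFunctor a a' a'')
  simp only [app_comp, app_whiskerLeft, app_whiskerRight] at h
  exact h

lemma multAt_left_unit (a : A) (b : B) :
    (λ_ ((F.obj a).obj b)).hom =
      unitAt F b ▷ (F.obj a).obj b ≫ multAt F (𝟙_ A) a b ≫ app (F.map (λ_ a).hom) b := by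
  have h := congrArg (fun σ => app σ b) (left_unitality F.toFunctor a)
  simp only [app_comp, app_whiskerRight] at h
  exact h

lemma multAt_right_unit (a : A) (b : B) :
    (ρ_ ((F.obj a).obj b)).hom =
      (F.obj a).obj b ◁ unitAt F b ≫ multAt F a (𝟙_ A) b ≫ app (F.map (ρ_ a).hom) b := by
  have h := congrArg (fun σ => app σ b) (right_unitality F.toFunctor a)
  simp only [app_comp, app_whiskerLeft] at h
  exact h

lemma multAt_braid (a a' : A) (b : B) :
    multAt F a a' b ≫ app (F.map (β_ a a').hom) b =
      (β_ ((F.obj a).obj b) ((F.obj a').obj b)).hom ≫ multAt F a' a b := by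
  have h := congrArg (fun σ => app σ b) (Functor.LaxBraided.braided (F := F.toFunctor) a a')
  simp only [app_comp] at h
  exact h

/-- The underlying functor of `F* b`, sending `a` to `F a b`. -/
def dualObjFunctor (b : B) : A ⥤ C where
  obj a := (F.obj a).obj b
  map f := app (F.map f) b
  map_id a := by rw [F.map_id, app_id]
  map_comp f g := by rw [F.map_comp, app_comp]

/-- The symmetric monoidal functor `F* b : A → C`, sending `a` to `F a b`, with structure arrows
`(F⁰)_b` and `(F²_{a,a'})_b`. -/
def dualObj (b : B) : LaxBraidedFunctor A C where
  toFunctor := dualObjFunctor F b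
  laxBraided :=
    { ε := unitAt F b
      μ := fun a a' => multAt F a a' b
      μ_natural_left := fun f a' => multAt_nat_left F f a' b
      μ_natural_right := fun a' f => multAt_nat_right F a' f b
      associativity := fun a a' a'' => multAt_assoc F a a' a'' b
      left_unitality := fun a => multAt_left_unit F a b
      right_unitality := fun a => multAt_right_unit F a b
      braided := fun a a' => multAt_braid F a a' b }

/-- The underlying functor of the dual `F*`. -/
def dualFunctor : B ⥤ LaxBraidedFunctor A C where
  obj b := dualObj F b
  map f := mkHom (fun a => (F.obj a).map f)
    (fun g => (app_nat (F.map g) f).symm)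
    (unitAt_nat F f)
    (fun a a' => multAt_nat F a a' f)
  map_id b := hom_ext fun a => (F.obj a).map_id b
  map_comp f g := hom_ext fun a => (F.obj a).map_comp f g

/-- The dual `F* : B → [A, C]` of `F : A → [B, C]`, with `F* b a = F a b` and structure arrows
given at `a` by those of `F a`. -/
def dual : LaxBraidedFunctor B (LaxBraidedFunctor A C) where
  toFunctor := dualFunctor F
  laxBraided :=
    { ε := mkHom (fun a => ε (F.obj a).toFunctor)
        (fun f => (Category.id_comp _).trans (app_unit (F.map f)).symm)
        ((Category.id_comp _).trans (unitAt_unit F).symm)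
        (fun a a' => (multAt_unit F a a').symm)
      μ := fun b b' => mkHom (fun a => μ (F.obj a).toFunctor b b')
        (fun f => (app_tens (F.map f) b b').symm)
        (by
          change ((λ_ (𝟙_ C)).inv ≫ (unitAt F b ⊗ₘ unitAt F b')) ≫
            μ (F.obj (𝟙_ A)).toFunctor b b' = unitAt F (b ⊗ b')
          rw [Category.assoc, unitAt_tens, Iso.inv_hom_id_assoc])
        (fun a a' => (Category.assoc _ _ _).trans (multAt_tens F a a' b b').symm)
      μ_natural_left := fun f b' => hom_ext fun a => by
        simp only [app_comp, app_whiskerRight]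
        exact μ_natural_left (F.obj a).toFunctor f b'
      μ_natural_right := fun b' f => hom_ext fun a => by
        simp only [app_comp, app_whiskerLeft]
        exact μ_natural_right (F.obj a).toFunctor b' f
      associativity := fun b b' b'' => hom_ext fun a => by
        simp only [app_comp, app_whiskerLeft, app_whiskerRight]
        exact associativity (F.obj a).toFunctor b b' b''
      left_unitality := fun b => hom_ext fun a => by
        simp only [app_comp, app_whiskerRight]
        exact left_unitality (F.obj a).toFunctor b
      right_unitality := fun b => hom_ext fun a => by
        simp only [app_comp, app_whiskerLeft]
        exact right_unitality (F.obj a).toFunctor b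
      braided := fun b b' => hom_ext fun a =>
        Functor.LaxBraided.braided (F := (F.obj a).toFunctor) b b' }

end Dual

/-- Evaluation `ev_a : [A, B] → B` at an object `a`: the value at `a` of the dual
`A → [[A, B], B]` of the identity of `[A, B]`. -/
def ev {A : Type u} (B : Type u)
    [SmallCategory A] [MonoidalCategory A] [SymmetricCategory A]
    [SmallCategory B] [MonoidalCategory B] [SymmetricCategory B] (a : A) :
    LaxBraidedFunctor (LaxBraidedFunctor A B) B :=
  (dual (idFun (LaxBraidedFunctor A B))).obj a

/-! ### Symmetric monoidal categories presented by generators and relations -/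

/-- The free algebra on `G` for one constant (the unit) and one binary operation (the tensor). -/
inductive Tree (G : Type u) : Type u
  | unit : Tree G
  | of (g : G) : Tree G
  | tensor (X Y : Tree G) : Tree G

/-- Formal arrows over generating edges `E`: formal composites and whiskerings of identities,
canonical arrows and generating edges. -/
inductive Formal {G : Type u} (E : Tree G → Tree G → Type u) : Tree G → Tree G → Type u
  | gen {X Y : Tree G} (e : E X Y) : Formal E X Y
  | id (X : Tree G) : Formal E X X
  | comp {X Y Z : Tree G} (f : Formal E X Y) (g : Formal E Y Z) : Formal E X Z
  | whiskerLeft (X : Tree G) {Y Z : Tree G} (f : Formal E Y Z) :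
      Formal E (.tensor X Y) (.tensor X Z)
  | whiskerRight {Y Z : Tree G} (f : Formal E Y Z) (X : Tree G) :
      Formal E (.tensor Y X) (.tensor Z X)
  | assocHom (X Y Z : Tree G) : Formal E (.tensor (.tensor X Y) Z) (.tensor X (.tensor Y Z))
  | assocInv (X Y Z : Tree G) : Formal E (.tensor X (.tensor Y Z)) (.tensor (.tensor X Y) Z)
  | leftHom (X : Tree G) : Formal E (.tensor .unit X) X
  | leftInv (X : Tree G) : Formal E X (.tensor .unit X)
  | rightHom (X : Tree G) : Formal E (.tensor X .unit) X
  | rightInv (X : Tree G) : Formal E X (.tensor X .unit)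
  | braid (X Y : Tree G) : Formal E (.tensor X Y) (.tensor Y X)

namespace Formal

variable {G : Type u} {E : Tree G → Tree G → Type u}

/-- The formal tensor of two formal arrows. -/
def tensorHom {X Y Z W : Tree G} (f : Formal E X Y) (g : Formal E Z W) :
    Formal E (.tensor X Z) (.tensor Y W) :=
  (f.whiskerRight Z).comp (g.whiskerLeft Y)

/-- The formal middle-four interchange. -/
def interchange (X Y Z W : Tree G) :
    Formal E (.tensor (.tensor X Y) (.tensor Z W)) (.tensor (.tensor X Z) (.tensor Y W)) :=
  (assocHom X Y (.tensor Z W)).comp <|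
    (whiskerLeft X (assocInv Y Z W)).comp <|
      (whiskerLeft X (whiskerRight (braid Y Z) W)).comp <|
        (whiskerLeft X (assocHom Z Y W)).comp (assocInv X Z (.tensor Y W))

/-- The smallest relation on formal arrows that contains `R`, is a congruence for composition and
for whiskering on both sides, and makes the formal arrows a symmetric monoidal category. -/
inductive Rel (R : ∀ X Y : Tree G, Formal E X Y → Formal E X Y → Prop) :
    ∀ {X Y : Tree G}, Formal E X Y → Formal E X Y → Prop
  | base {X Y} {f g : Formal E X Y} (h : R X Y f g) : Rel R f g
  | refl {X Y} (f : Formal E X Y) : Rel R f f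
  | symm {X Y} {f g : Formal E X Y} (h : Rel R f g) : Rel R g f
  | trans {X Y} {f g h : Formal E X Y} (h₁ : Rel R f g) (h₂ : Rel R g h) : Rel R f h
  | comp {X Y Z} {f f' : Formal E X Y} {g g' : Formal E Y Z} (h₁ : Rel R f f')
      (h₂ : Rel R g g') : Rel R (f.comp g) (f'.comp g')
  | whiskerLeft (X) {Y Z} {f f' : Formal E Y Z} (h : Rel R f f') :
      Rel R (f.whiskerLeft X) (f'.whiskerLeft X)
  | whiskerRight {Y Z} {f f' : Formal E Y Z} (h : Rel R f f') (X) :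
      Rel R (f.whiskerRight X) (f'.whiskerRight X)
  | id_comp {X Y} (f : Formal E X Y) : Rel R ((Formal.id X).comp f) f
  | comp_id {X Y} (f : Formal E X Y) : Rel R (f.comp (Formal.id Y)) f
  | assoc {X Y Z W} (f : Formal E X Y) (g : Formal E Y Z) (h : Formal E Z W) :
      Rel R ((f.comp g).comp h) (f.comp (g.comp h))
  | whiskerLeft_id (X Y) : Rel R ((Formal.id Y).whiskerLeft X) (Formal.id (.tensor X Y))
  | whiskerLeft_comp (X) {Y Z W} (f : Formal E Y Z) (g : Formal E Z W) :
      Rel R ((f.comp g).whiskerLeft X) ((f.whiskerLeft X).comp (g.whiskerLeft X))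
  | id_whiskerRight (X Y) : Rel R ((Formal.id X).whiskerRight Y) (Formal.id (.tensor X Y))
  | comp_whiskerRight {Y Z W} (f : Formal E Y Z) (g : Formal E Z W) (X) :
      Rel R ((f.comp g).whiskerRight X) ((f.whiskerRight X).comp (g.whiskerRight X))
  | exchange {X Y Z W} (t : Formal E X Y) (s : Formal E Z W) :
      Rel R ((s.whiskerLeft X).comp (t.whiskerRight W)) ((t.whiskerRight Z).comp (s.whiskerLeft Y))
  | assoc_hom_inv (X Y Z) : Rel R ((assocHom X Y Z).comp (assocInv X Y Z)) (Formal.id _)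
  | assoc_inv_hom (X Y Z) : Rel R ((assocInv X Y Z).comp (assocHom X Y Z)) (Formal.id _)
  | left_hom_inv (X) : Rel R ((leftHom X).comp (leftInv X)) (Formal.id _)
  | left_inv_hom (X) : Rel R ((leftInv X).comp (leftHom X)) (Formal.id _)
  | right_hom_inv (X) : Rel R ((rightHom X).comp (rightInv X)) (Formal.id _)
  | right_inv_hom (X) : Rel R ((rightInv X).comp (rightHom X)) (Formal.id _)
  | braid_braid (X Y) : Rel R ((braid X Y).comp (braid Y X)) (Formal.id _)
  | pentagon (X Y Z W) :
      Rel R (((assocHom X Y Z).whiskerRight W).comp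
          ((assocHom X (.tensor Y Z) W).comp ((assocHom Y Z W).whiskerLeft X)))
        ((assocHom (.tensor X Y) Z W).comp (assocHom X Y (.tensor Z W)))
  | triangle (X Y) :
      Rel R ((assocHom X .unit Y).comp ((leftHom Y).whiskerLeft X)) ((rightHom X).whiskerRight Y)
  | braid_left (X) : Rel R ((braid X .unit).comp (leftHom X)) (rightHom X)
  | hexagon (X Y Z) :
      Rel R ((assocHom X Y Z).comp ((braid X (.tensor Y Z)).comp (assocHom Y Z X)))
        (((braid X Y).whiskerRight Z).comp
          ((assocHom Y X Z).comp ((braid X Z).whiskerLeft Y)))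
  | assoc_nat_left {X X'} (f : Formal E X X') (Y Z) :
      Rel R (((f.whiskerRight Y).whiskerRight Z).comp (assocHom X' Y Z))
        ((assocHom X Y Z).comp (f.whiskerRight (.tensor Y Z)))
  | assoc_nat_middle (X) {Y Y'} (f : Formal E Y Y') (Z) :
      Rel R (((f.whiskerLeft X).whiskerRight Z).comp (assocHom X Y' Z))
        ((assocHom X Y Z).comp ((f.whiskerRight Z).whiskerLeft X))
  | assoc_nat_right (X Y) {Z Z'} (f : Formal E Z Z') :
      Rel R ((f.whiskerLeft (.tensor X Y)).comp (assocHom X Y Z'))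
        ((assocHom X Y Z).comp ((f.whiskerLeft Y).whiskerLeft X))
  | left_nat {X Y} (f : Formal E X Y) :
      Rel R ((f.whiskerLeft .unit).comp (leftHom Y)) ((leftHom X).comp f)
  | right_nat {X Y} (f : Formal E X Y) :
      Rel R ((f.whiskerRight .unit).comp (rightHom Y)) ((rightHom X).comp f)
  | braid_nat_left {X Y} (f : Formal E X Y) (Z) :
      Rel R ((f.whiskerRight Z).comp (braid Y Z)) ((braid X Z).comp (f.whiskerLeft Z))
  | braid_nat_right (Z) {X Y} (f : Formal E X Y) :
      Rel R ((f.whiskerLeft Z).comp (braid Z Y)) ((braid Z X).comp (f.whiskerRight Z))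

end Formal

/-- A presentation of a symmetric monoidal category: generating objects, generating edges between
words in the generating objects, and relations between formal arrows. -/
structure Presentation where
  /-- generating objects -/
  Gen : Type u
  /-- generating edges -/
  Edge : Tree Gen → Tree Gen → Type u
  /-- relations -/
  Rel : ∀ X Y : Tree Gen, Formal Edge X Y → Formal Edge X Y → Prop

namespace Presentation

variable (P : Presentation.{u})

/-- The presented symmetric monoidal category: its objects are the words in the generating
objects. -/
def Cat : Type u := Tree P.Gen

/-- Equivalence of formal arrows. -/
def homSetoid (X Y : Tree P.Gen) : Setoid (Formal P.Edge X Y) where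
  r := Formal.Rel P.Rel
  iseqv := ⟨.refl, .symm, .trans⟩

/-- The arrows of the presented category: classes of formal arrows. -/
instance category : SmallCategory P.Cat where
  Hom X Y := Quotient (P.homSetoid X Y)
  id X := Quotient.mk _ (Formal.id X)
  comp {X Y Z} f g := Quotient.map₂ (sa := P.homSetoid X Y) (sb := P.homSetoid Y Z)
    (sc := P.homSetoid X Z) Formal.comp (fun _ _ h₁ _ _ h₂ => Formal.Rel.comp h₁ h₂) f g
  id_comp := by
    rintro X Y ⟨f⟩
    exact Quotient.sound (s := P.homSetoid _ _) (.id_comp f)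
  comp_id := by
    rintro X Y ⟨f⟩
    exact Quotient.sound (s := P.homSetoid _ _) (.comp_id f)
  assoc := by
    rintro X Y Z W ⟨f⟩ ⟨g⟩ ⟨h⟩
    exact Quotient.sound (s := P.homSetoid _ _) (.assoc f g h)

/-- The class of a formal arrow. -/
def arr {X Y : P.Cat} (f : Formal P.Edge X Y) : X ⟶ Y := Quotient.mk (P.homSetoid X Y) f

variable {P}

lemma arr_sound {X Y : P.Cat} {f g : Formal P.Edge X Y} (h : Formal.Rel P.Rel f g) :
    P.arr f = P.arr g := Quotient.sound (s := P.homSetoid X Y) h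

/-- Whiskering on the left. -/
def whiskerLeft (X : P.Cat) {Y Z : P.Cat} (f : Y ⟶ Z) :
    (show P.Cat from .tensor X Y) ⟶ (show P.Cat from .tensor X Z) :=
  Quotient.map (sa := P.homSetoid Y Z) (sb := P.homSetoid (.tensor X Y) (.tensor X Z))
    (Formal.whiskerLeft X) (fun _ _ h => .whiskerLeft X h) f

/-- Whiskering on the right. -/
def whiskerRight {Y Z : P.Cat} (f : Y ⟶ Z) (X : P.Cat) :
    (show P.Cat from .tensor Y X) ⟶ (show P.Cat from .tensor Z X) :=
  Quotient.map (sa := P.homSetoid Y Z) (sb := P.homSetoid (.tensor Y X) (.tensor Z X))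
    (fun g => Formal.whiskerRight g X) (fun _ _ h => .whiskerRight h X) f

instance monoidalStruct : MonoidalCategoryStruct P.Cat where
  tensorObj X Y := Tree.tensor X Y
  tensorUnit := Tree.unit
  whiskerLeft := whiskerLeft
  whiskerRight := whiskerRight
  associator X Y Z :=
    { hom := P.arr (.assocHom X Y Z)
      inv := P.arr (.assocInv X Y Z)
      hom_inv_id := arr_sound (.assoc_hom_inv X Y Z)
      inv_hom_id := arr_sound (.assoc_inv_hom X Y Z) }
  leftUnitor X :=
    { hom := P.arr (.leftHom X)
      inv := P.arr (.leftInv X)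
      hom_inv_id := arr_sound (.left_hom_inv X)
      inv_hom_id := arr_sound (.left_inv_hom X) }
  rightUnitor X :=
    { hom := P.arr (.rightHom X)
      inv := P.arr (.rightInv X)
      hom_inv_id := arr_sound (.right_hom_inv X)
      inv_hom_id := arr_sound (.right_inv_hom X) }

lemma whiskerLeft_id (X Y : P.Cat) : X ◁ 𝟙 Y = 𝟙 (X ⊗ Y) := arr_sound (.whiskerLeft_id X Y)

lemma whiskerLeft_comp (X : P.Cat) {Y Z W : P.Cat} (f : Y ⟶ Z) (g : Z ⟶ W) :
    X ◁ (f ≫ g) = X ◁ f ≫ X ◁ g := by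
  obtain ⟨f⟩ := f
  obtain ⟨g⟩ := g
  exact arr_sound (.whiskerLeft_comp X f g)

lemma id_whiskerRight (X Y : P.Cat) : 𝟙 X ▷ Y = 𝟙 (X ⊗ Y) := arr_sound (.id_whiskerRight X Y)

lemma comp_whiskerRight {Y Z W : P.Cat} (f : Y ⟶ Z) (g : Z ⟶ W) (X : P.Cat) :
    (f ≫ g) ▷ X = f ▷ X ≫ g ▷ X := by
  obtain ⟨f⟩ := f
  obtain ⟨g⟩ := g
  exact arr_sound (.comp_whiskerRight f g X)

lemma exchange {X Y Z W : P.Cat} (f : X ⟶ Y) (g : Z ⟶ W) :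
    X ◁ g ≫ f ▷ W = f ▷ Z ≫ Y ◁ g := by
  obtain ⟨f⟩ := f
  obtain ⟨g⟩ := g
  exact arr_sound (.exchange f g)

lemma tensorHom_eq {X Y Z W : P.Cat} (f : X ⟶ Y) (g : Z ⟶ W) :
    f ⊗ₘ g = f ▷ Z ≫ Y ◁ g := rfl

lemma assoc_nat {X₁ X₂ X₃ Y₁ Y₂ Y₃ : P.Cat} (f₁ : X₁ ⟶ Y₁) (f₂ : X₂ ⟶ Y₂) (f₃ : X₃ ⟶ Y₃) :
    ((f₁ ⊗ₘ f₂) ⊗ₘ f₃) ≫ (α_ Y₁ Y₂ Y₃).hom = (α_ X₁ X₂ X₃).hom ≫ (f₁ ⊗ₘ (f₂ ⊗ₘ f₃)) := by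
  have h₁ : f₁ ▷ X₂ ▷ X₃ ≫ (α_ Y₁ X₂ X₃).hom = (α_ X₁ X₂ X₃).hom ≫ f₁ ▷ (X₂ ⊗ X₃) := by
    obtain ⟨f₁⟩ := f₁
    exact arr_sound (.assoc_nat_left f₁ X₂ X₃)
  have h₂ : (Y₁ ◁ f₂) ▷ X₃ ≫ (α_ Y₁ Y₂ X₃).hom = (α_ Y₁ X₂ X₃).hom ≫ Y₁ ◁ f₂ ▷ X₃ := by
    obtain ⟨f₂⟩ := f₂
    exact arr_sound (.assoc_nat_middle Y₁ f₂ X₃)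
  have h₃ : (Y₁ ⊗ Y₂) ◁ f₃ ≫ (α_ Y₁ Y₂ Y₃).hom = (α_ Y₁ Y₂ X₃).hom ≫ Y₁ ◁ Y₂ ◁ f₃ := by
    obtain ⟨f₃⟩ := f₃
    exact arr_sound (.assoc_nat_right Y₁ Y₂ f₃)
  simp only [tensorHom_eq, comp_whiskerRight, whiskerLeft_comp, Category.assoc]
  have h₁' := congrArg (· ≫ Y₁ ◁ f₂ ▷ X₃ ≫ Y₁ ◁ Y₂ ◁ f₃) h₁
  have h₂' := congrArg (· ≫ Y₁ ◁ Y₂ ◁ f₃) h₂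
  simp only [Category.assoc] at h₁' h₂'
  rw [h₃, h₂', h₁']

instance monoidal : MonoidalCategory P.Cat where
  tensorHom_def _ _ := rfl
  id_tensorHom_id X Y := by
    rw [tensorHom_eq, id_whiskerRight, whiskerLeft_id, Category.id_comp]
  tensorHom_comp_tensorHom f₁ f₂ g₁ g₂ := by
    simp only [tensorHom_eq, comp_whiskerRight, whiskerLeft_comp, Category.assoc]
    rw [← Category.assoc (_ ◁ f₂), exchange, Category.assoc]
  whiskerLeft_id := whiskerLeft_id
  id_whiskerRight := id_whiskerRight
  associator_naturality := assoc_nat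
  leftUnitor_naturality := by
    rintro X Y ⟨f⟩
    exact arr_sound (.left_nat f)
  rightUnitor_naturality := by
    rintro X Y ⟨f⟩
    exact arr_sound (.right_nat f)
  pentagon X Y Z W := arr_sound (.pentagon X Y Z W)
  triangle X Y := arr_sound (.triangle X Y)

/-- The symmetry isomorphism. -/
def braiding (X Y : P.Cat) : X ⊗ Y ≅ Y ⊗ X where
  hom := P.arr (.braid X Y)
  inv := P.arr (.braid Y X)
  hom_inv_id := arr_sound (.braid_braid X Y)
  inv_hom_id := arr_sound (.braid_braid Y X)

lemma hexagon (X Y Z : P.Cat) :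
    (α_ X Y Z).hom ≫ (braiding X (Y ⊗ Z)).hom ≫ (α_ Y Z X).hom =
      (braiding X Y).hom ▷ Z ≫ (α_ Y X Z).hom ≫ Y ◁ (braiding X Z).hom :=
  arr_sound (.hexagon X Y Z)

instance symmetric : SymmetricCategory P.Cat where
  braiding := braiding
  braiding_naturality_left := by
    rintro X Y ⟨f⟩ Z
    exact arr_sound (.braid_nat_left f Z)
  braiding_naturality_right := by
    rintro X Y Z ⟨f⟩
    exact arr_sound (.braid_nat_right X f)
  hexagon_forward := hexagon
  hexagon_reverse X Y Z := by
    have h : α_ Z X Y ≪≫ braiding Z (X ⊗ Y) ≪≫ α_ X Y Z =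
        whiskerRightIso (braiding Z X) Y ≪≫ α_ X Z Y ≪≫ whiskerLeftIso X (braiding Z Y) :=
      Iso.ext (hexagon Z X Y)
    have h' := congrArg Iso.inv h
    simp only [Iso.trans_inv, Category.assoc, whiskerRightIso_inv, whiskerLeftIso_inv] at h'
    exact h'
  symmetry X Y := arr_sound (.braid_braid X Y)

/-! ### Strict functors out of a presented category -/

section Lift

variable {C : Type u} [SmallCategory C] [MonoidalCategory C] [SymmetricCategory C]

/-- The value of the word `X` under an assignment `φ` of the generating objects. -/
def liftObj {G : Type u} (φ : G → C) : Tree G → C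
  | .unit => 𝟙_ C
  | .of g => φ g
  | .tensor X Y => liftObj φ X ⊗ liftObj φ Y

/-- The value of a formal arrow under an assignment `ψ` of the generating edges. -/
def liftArr {G : Type u} {E : Tree G → Tree G → Type u} (φ : G → C)
    (ψ : ∀ X Y, E X Y → (liftObj φ X ⟶ liftObj φ Y)) :
    ∀ {X Y : Tree G}, Formal E X Y → (liftObj φ X ⟶ liftObj φ Y)
  | _, _, .gen e => ψ _ _ e
  | _, _, .id X => 𝟙 (liftObj φ X)
  | _, _, .comp f g => liftArr φ ψ f ≫ liftArr φ ψ g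
  | _, _, .whiskerLeft X f => liftObj φ X ◁ liftArr φ ψ f
  | _, _, .whiskerRight f X => liftArr φ ψ f ▷ liftObj φ X
  | _, _, .assocHom X Y Z => (α_ (liftObj φ X) (liftObj φ Y) (liftObj φ Z)).hom
  | _, _, .assocInv X Y Z => (α_ (liftObj φ X) (liftObj φ Y) (liftObj φ Z)).inv
  | _, _, .leftHom X => (λ_ (liftObj φ X)).hom
  | _, _, .leftInv X => (λ_ (liftObj φ X)).inv
  | _, _, .rightHom X => (ρ_ (liftObj φ X)).hom
  | _, _, .rightInv X => (ρ_ (liftObj φ X)).inv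
  | _, _, .braid X Y => (β_ (liftObj φ X) (liftObj φ Y)).hom

variable (P) (φ : P.Gen → C) (ψ : ∀ X Y, P.Edge X Y → (liftObj φ X ⟶ liftObj φ Y))

lemma liftArr_rel
    (hψ : ∀ (X Y : Tree P.Gen) (f g : Formal P.Edge X Y), P.Rel X Y f g →
      liftArr φ ψ f = liftArr φ ψ g)
    {X Y : Tree P.Gen} {f g : Formal P.Edge X Y} (h : Formal.Rel P.Rel f g) :
    liftArr φ ψ f = liftArr φ ψ g := by
  induction h with
  | base h => exact hψ _ _ _ _ h
  | refl f => rfl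
  | symm _ ih => exact ih.symm
  | trans _ _ ih₁ ih₂ => exact ih₁.trans ih₂
  | comp _ _ ih₁ ih₂ => simp only [liftArr, ih₁, ih₂]
  | whiskerLeft X _ ih => exact congrArg (fun k => liftObj φ X ◁ k) ih
  | whiskerRight _ X ih => exact congrArg (fun k => k ▷ liftObj φ X) ih
  | exchange t s => exact whisker_exchange _ _
  | braid_nat_left f Z => exact BraidedCategory.braiding_naturality_left _ _
  | braid_nat_right Z f => exact BraidedCategory.braiding_naturality_right _ _
  | hexagon X Y Z => exact BraidedCategory.hexagon_forward _ _ _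
  | braid_left X => exact braiding_leftUnitor _
  | braid_braid X Y => exact SymmetricCategory.symmetry _ _
  | _ => simp [liftArr, liftObj]

/-- The strict symmetric monoidal functor out of a presented category determined by its values
`φ` on the generating objects and `ψ` on the generating edges. -/
def lift
    (hψ : ∀ (X Y : Tree P.Gen) (f g : Formal P.Edge X Y), P.Rel X Y f g →
      liftArr φ ψ f = liftArr φ ψ g) : LaxBraidedFunctor P.Cat C where
  toFunctor :=
    { obj := liftObj φ
      map := fun {X Y} f => Quotient.lift (s := P.homSetoid X Y) (liftArr φ ψ)
        (fun _ _ h => liftArr_rel P φ ψ hψ h) f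
      map_id := fun _ => rfl
      map_comp := by
        rintro X Y Z ⟨f⟩ ⟨g⟩
        rfl }
  laxBraided :=
    { ε := 𝟙 (𝟙_ C)
      μ := fun X Y => 𝟙 (liftObj φ X ⊗ liftObj φ Y)
      μ_natural_left := by
        rintro X Y ⟨f⟩ Z
        exact (Category.comp_id _).trans (Category.id_comp _).symm
      μ_natural_right := by
        rintro X Y Z ⟨f⟩
        exact (Category.comp_id _).trans (Category.id_comp _).symm
      associativity := fun X Y Z => by
        change 𝟙 (liftObj φ X ⊗ liftObj φ Y) ▷ liftObj φ Z ≫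
            𝟙 ((liftObj φ X ⊗ liftObj φ Y) ⊗ liftObj φ Z) ≫ (α_ _ _ _).hom =
          (α_ _ _ _).hom ≫ liftObj φ X ◁ 𝟙 (liftObj φ Y ⊗ liftObj φ Z) ≫ 𝟙 _
        simp
      left_unitality := fun X => by
        change (λ_ (liftObj φ X)).hom = 𝟙 (𝟙_ C) ▷ liftObj φ X ≫ 𝟙 _ ≫ (λ_ (liftObj φ X)).hom
        simp
      right_unitality := fun X => by
        change (ρ_ (liftObj φ X)).hom = liftObj φ X ◁ 𝟙 (𝟙_ C) ≫ 𝟙 _ ≫ (ρ_ (liftObj φ X)).hom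
        simp
      braided := fun X Y => (Category.id_comp _).trans (Category.comp_id _).symm }

end Lift

end Presentation

open Presentation

/-! ### The free symmetric monoidal category on one object -/

/-- The presentation with one generating object, no generating edge and no relation. -/
def uncPres : Presentation.{u} where
  Gen := PUnit
  Edge _ _ := PEmpty
  Rel _ _ _ _ := False

/-- The free symmetric monoidal category on one object. -/
abbrev Unc : Type u := uncPres.{u}.Cat

/-- The generating object of `Unc`. -/
def star : Unc.{u} := Tree.of PUnit.unit

/-- The strict symmetric monoidal functor `Unc → [A, A]` sending the generating object to the
identity of `A`. -/
def v (A : Type u) [SmallCategory A] [MonoidalCategory A] [SymmetricCategory A] :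
    LaxBraidedFunctor Unc.{u} (LaxBraidedFunctor A A) :=
  lift uncPres.{u} (fun _ => idFun A) (fun _ _ e => e.elim) (fun _ _ _ _ h => h.elim)

/-! ### The tensor `A ⊗ B` -/

section Tensor

variable (A B : Type u)
  [SmallCategory A] [MonoidalCategory A] [SymmetricCategory A]
  [SmallCategory B] [MonoidalCategory B] [SymmetricCategory B]

variable {A B} in
/-- The generating object `a ⊗ b`. -/
abbrev word (a : A) (b : B) : Tree (A × B) := .of (a, b)

/-- The generating edges of `A ⊗ B`. -/
inductive TensorEdge : Tree (A × B) → Tree (A × B) → Type u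
  | alpha (b : B) : TensorEdge .unit (word (𝟙_ A) b)
  | beta (a : A) : TensorEdge .unit (word a (𝟙_ B))
  | gamma (a a' : A) (b : B) : TensorEdge (.tensor (word a b) (word a' b)) (word (a ⊗ a') b)
  | delta (a : A) (b b' : B) : TensorEdge (.tensor (word a b) (word a b')) (word a (b ⊗ b'))
  | mapLeft {a a' : A} (f : a ⟶ a') (b : B) : TensorEdge (word a b) (word a' b)
  | mapRight (a : A) {b b' : B} (g : b ⟶ b') : TensorEdge (word a b) (word a b')

section Edges

variable {A B}

/-- `α_b : I → I_A ⊗ b` -/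
def al (b : B) : Formal (TensorEdge A B) .unit (word (𝟙_ A) b) := .gen (.alpha b)

/-- `β_a : I → a ⊗ I_B` -/
def be (a : A) : Formal (TensorEdge A B) .unit (word a (𝟙_ B)) := .gen (.beta a)

/-- `γ_{a,a',b} : (a ⊗ b) ⊗ (a' ⊗ b) → (a ⊗ a') ⊗ b` -/
def ga (a a' : A) (b : B) :
    Formal (TensorEdge A B) (.tensor (word a b) (word a' b)) (word (a ⊗ a') b) :=
  .gen (.gamma a a' b)

/-- `δ_{a,b,b'} : (a ⊗ b) ⊗ (a ⊗ b') → a ⊗ (b ⊗ b')` -/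
def de (a : A) (b b' : B) :
    Formal (TensorEdge A B) (.tensor (word a b) (word a b')) (word a (b ⊗ b')) :=
  .gen (.delta a b b')

/-- `f ⊗ b : a ⊗ b → a' ⊗ b` -/
def ml {a a' : A} (f : a ⟶ a') (b : B) : Formal (TensorEdge A B) (word a b) (word a' b) :=
  .gen (.mapLeft f b)

/-- `a ⊗ g : a ⊗ b → a ⊗ b'` -/
def mr (a : A) {b b' : B} (g : b ⟶ b') : Formal (TensorEdge A B) (word a b) (word a b') :=
  .gen (.mapRight a g)

end Edges

/-- The relations of `A ⊗ B` besides those of a symmetric monoidal category. -/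
inductive TensorRel : ∀ X Y : Tree (A × B),
    Formal (TensorEdge A B) X Y → Formal (TensorEdge A B) X Y → Prop
  | mapRight_comp (a : A) {b b' b'' : B} (f : b ⟶ b') (g : b' ⟶ b'') :
      TensorRel _ _ (mr a (f ≫ g)) ((mr a f).comp (mr a g))
  | mapLeft_comp {a a' a'' : A} (f : a ⟶ a') (g : a' ⟶ a'') (b : B) :
      TensorRel _ _ (ml (f ≫ g) b) ((ml f b).comp (ml g b))
  | mapRight_id (a : A) (b : B) : TensorRel _ _ (mr a (𝟙 b)) (.id (word a b))
  | mapLeft_id (a : A) (b : B) : TensorRel _ _ (ml (𝟙 a) b) (.id (word a b))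
  | bifunctor {a a' : A} (f : a ⟶ a') {b b' : B} (g : b ⟶ b') :
      TensorRel _ _ ((ml f b).comp (mr a' g)) ((mr a g).comp (ml f b'))
  | alpha_nat {b b' : B} (g : b ⟶ b') : TensorRel _ _ ((al b).comp (mr (𝟙_ A) g)) (al b')
  | beta_nat {a a' : A} (f : a ⟶ a') : TensorRel _ _ ((be a).comp (ml f (𝟙_ B))) (be a')
  | gamma_nat_left {a₁ a₂ : A} (f : a₁ ⟶ a₂) (a' : A) (b : B) :
      TensorRel _ _ (((ml f b).whiskerRight (word a' b)).comp (ga a₂ a' b))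
        ((ga a₁ a' b).comp (ml (f ▷ a') b))
  | gamma_nat_right (a : A) {a₁ a₂ : A} (f : a₁ ⟶ a₂) (b : B) :
      TensorRel _ _ (((ml f b).whiskerLeft (word a b)).comp (ga a a₂ b))
        ((ga a a₁ b).comp (ml (a ◁ f) b))
  | gamma_nat (a a' : A) {b b' : B} (g : b ⟶ b') :
      TensorRel _ _ (((mr a g).tensorHom (mr a' g)).comp (ga a a' b'))
        ((ga a a' b).comp (mr (a ⊗ a') g))
  | delta_nat {a a' : A} (f : a ⟶ a') (b b' : B) :
      TensorRel _ _ (((ml f b).tensorHom (ml f b')).comp (de a' b b'))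
        ((de a b b').comp (ml f (b ⊗ b')))
  | delta_nat_left (a : A) {b₁ b₂ : B} (g : b₁ ⟶ b₂) (b' : B) :
      TensorRel _ _ (((mr a g).whiskerRight (word a b')).comp (de a b₂ b'))
        ((de a b₁ b').comp (mr a (g ▷ b')))
  | delta_nat_right (a : A) (b : B) {b₁ b₂ : B} (g : b₁ ⟶ b₂) :
      TensorRel _ _ (((mr a g).whiskerLeft (word a b)).comp (de a b b₂))
        ((de a b b₁).comp (mr a (b ◁ g)))
  | delta_assoc (a : A) (b b' b'' : B) :
      TensorRel _ _
        (((de a b b').whiskerRight (word a b'')).comp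
          ((de a (b ⊗ b') b'').comp (mr a (α_ b b' b'').hom)))
        ((Formal.assocHom (word a b) (word a b') (word a b'')).comp
          (((de a b' b'').whiskerLeft (word a b)).comp (de a b (b' ⊗ b''))))
  | delta_left_unit (a : A) (b : B) :
      TensorRel _ _ (Formal.leftHom (word a b))
        (((be a).whiskerRight (word a b)).comp ((de a (𝟙_ B) b).comp (mr a (λ_ b).hom)))
  | delta_right_unit (a : A) (b : B) :
      TensorRel _ _ (Formal.rightHom (word a b))
        (((be a).whiskerLeft (word a b)).comp ((de a b (𝟙_ B)).comp (mr a (ρ_ b).hom)))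
  | delta_braid (a : A) (b b' : B) :
      TensorRel _ _ ((de a b b').comp (mr a (β_ b b').hom))
        ((Formal.braid (word a b) (word a b')).comp (de a b' b))
  | gamma_assoc (a a' a'' : A) (b : B) :
      TensorRel _ _
        (((ga a a' b).whiskerRight (word a'' b)).comp
          ((ga (a ⊗ a') a'' b).comp (ml (α_ a a' a'').hom b)))
        ((Formal.assocHom (word a b) (word a' b) (word a'' b)).comp
          (((ga a' a'' b).whiskerLeft (word a b)).comp (ga a (a' ⊗ a'') b)))
  | gamma_left_unit (a : A) (b : B) :
      TensorRel _ _ (Formal.leftHom (word a b))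
        (((al b).whiskerRight (word a b)).comp ((ga (𝟙_ A) a b).comp (ml (λ_ a).hom b)))
  | gamma_right_unit (a : A) (b : B) :
      TensorRel _ _ (Formal.rightHom (word a b))
        (((al b).whiskerLeft (word a b)).comp ((ga a (𝟙_ A) b).comp (ml (ρ_ a).hom b)))
  | gamma_braid (a a' : A) (b : B) :
      TensorRel _ _ ((ga a a' b).comp (ml (β_ a a').hom b))
        ((Formal.braid (word a b) (word a' b)).comp (ga a' a b))
  | delta_alpha (b b' : B) :
      TensorRel _ _ (((al b).tensorHom (al b')).comp (de (𝟙_ A) b b'))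
        ((Formal.leftHom .unit).comp (al (b ⊗ b')))
  | gamma_beta (a a' : A) :
      TensorRel _ _ (((be a).tensorHom (be a')).comp (ga a a' (𝟙_ B)))
        ((Formal.leftHom .unit).comp (be (a ⊗ a')))
  | beta_alpha : TensorRel _ _ (be (𝟙_ A)) (al (𝟙_ B))
  | gamma_delta (a a' : A) (b b' : B) :
      TensorRel _ _
        (((de a b b').tensorHom (de a' b b')).comp (ga a a' (b ⊗ b')))
        ((Formal.interchange (word a b) (word a b') (word a' b) (word a' b')).comp
          (((ga a a' b).tensorHom (ga a a' b')).comp (de (a ⊗ a') b b')))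

/-- The presentation of `A ⊗ B`. -/
def tensorPres : Presentation.{u} where
  Gen := A × B
  Edge := TensorEdge A B
  Rel := TensorRel A B

/-- The tensor `A ⊗ B` of two symmetric monoidal categories. -/
abbrev Tens : Type u := (tensorPres A B).Cat

variable {A B} in
lemma tens_sound {X Y : Tens A B} {f g : Formal (TensorEdge A B) X Y} (h : TensorRel A B X Y f g) :
    (tensorPres A B).arr f = (tensorPres A B).arr g := arr_sound (.base h)

/-- The symmetric monoidal functor `η(a) : B → A ⊗ B`, sending `b` to `a ⊗ b`. -/
def etaObj (a : A) : LaxBraidedFunctor B (Tens A B) where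
  toFunctor :=
    { obj := fun b => word a b
      map := fun g => (tensorPres A B).arr (mr a g)
      map_id := fun b => tens_sound (.mapRight_id a b)
      map_comp := fun f g => tens_sound (.mapRight_comp a f g) }
  laxBraided :=
    { ε := (tensorPres A B).arr (be a)
      μ := fun b b' => (tensorPres A B).arr (de a b b')
      μ_natural_left := fun g b' => tens_sound (.delta_nat_left a g b')
      μ_natural_right := fun b g => tens_sound (.delta_nat_right a b g)
      associativity := fun b b' b'' => tens_sound (.delta_assoc a b b' b'')
      left_unitality := fun b => tens_sound (.delta_left_unit a b)
      right_unitality := fun b => tens_sound (.delta_right_unit a b)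
      braided := fun b b' => tens_sound (.delta_braid a b b') }

/-- The underlying functor of `η`. -/
def etaFunctor : A ⥤ LaxBraidedFunctor B (Tens A B) where
  obj a := etaObj A B a
  map f := mkHom (fun b => (tensorPres A B).arr (ml f b))
    (fun g => (tens_sound (.bifunctor f g)).symm)
    (tens_sound (.beta_nat f))
    (fun b b' => (tens_sound (.delta_nat f b b')).symm)
  map_id a := hom_ext fun b => tens_sound (.mapLeft_id a b)
  map_comp f g := hom_ext fun b => tens_sound (.mapLeft_comp f g b)

/-- The symmetric monoidal functor `η : A → [B, A ⊗ B]`. -/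
def eta : LaxBraidedFunctor A (LaxBraidedFunctor B (Tens A B)) where
  toFunctor := etaFunctor A B
  laxBraided :=
    { ε := mkHom (fun b => (tensorPres A B).arr (al b))
        (fun g => (Category.id_comp _).trans (tens_sound (.alpha_nat g)).symm)
        ((Category.id_comp _).trans (tens_sound .beta_alpha).symm)
        (fun b b' => (tens_sound (.delta_alpha b b')).symm)
      μ := fun a a' => mkHom (fun b => (tensorPres A B).arr (ga a a' b))
        (fun g => tens_sound (.gamma_nat a a' g))
        (unit_shift (tens_sound (.gamma_beta a a')))
        (fun b b' => tensorμ_shift (tens_sound (.gamma_delta a a' b b')))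
      μ_natural_left := fun f a' => hom_ext fun b => by
        simp only [app_comp, app_whiskerRight]
        exact tens_sound (.gamma_nat_left f a' b)
      μ_natural_right := fun a f => hom_ext fun b => by
        simp only [app_comp, app_whiskerLeft]
        exact tens_sound (.gamma_nat_right a f b)
      associativity := fun a a' a'' => hom_ext fun b => by
        simp only [app_comp, app_whiskerLeft, app_whiskerRight]
        exact tens_sound (.gamma_assoc a a' a'' b)
      left_unitality := fun a => hom_ext fun b => by
        simp only [app_comp, app_whiskerRight]
        exact tens_sound (.gamma_left_unit a b)
      right_unitality := fun a => hom_ext fun b => by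
        simp only [app_comp, app_whiskerLeft]
        exact tens_sound (.gamma_right_unit a b)
      braided := fun a a' => hom_ext fun b => tens_sound (.gamma_braid a a' b) }

section En

variable {A B} {C : Type u} [SmallCategory C] [MonoidalCategory C] [SymmetricCategory C]
  (F : LaxBraidedFunctor A (LaxBraidedFunctor B C))

/-- The value of `En F` on the generating object `a ⊗ b`. -/
def enObj (p : A × B) : C := (F.obj p.1).obj p.2

/-- The value of `En F` on the generating edges. -/
def enEdge : ∀ X Y : Tree (A × B), TensorEdge A B X Y →
    (liftObj (enObj F) X ⟶ liftObj (enObj F) Y)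
  | _, _, .alpha b => unitAt F b
  | _, _, .beta a => ε (F.obj a).toFunctor
  | _, _, .gamma a a' b => multAt F a a' b
  | _, _, .delta a b b' => μ (F.obj a).toFunctor b b'
  | _, _, .mapLeft f b => app (F.map f) b
  | _, _, .mapRight a g => (F.obj a).map g

lemma en_rel (X Y : Tree (A × B)) (f g : Formal (TensorEdge A B) X Y) (h : TensorRel A B X Y f g) :
    liftArr (enObj F) (enEdge F) f = liftArr (enObj F) (enEdge F) g := by
  cases h with
  | mapRight_comp a f g => exact (F.obj a).map_comp f g
  | mapLeft_comp f g b => exact (congrArg (fun σ => app σ b) (F.map_comp f g)).trans rfl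
  | mapRight_id a b => exact (F.obj a).map_id b
  | mapLeft_id a b => exact (congrArg (fun σ => app σ b) (F.map_id a)).trans rfl
  | bifunctor f g => exact (app_nat (F.map f) g).symm
  | alpha_nat g => exact unitAt_nat F g
  | beta_nat f => exact app_unit (F.map f)
  | gamma_nat_left f a' b => exact multAt_nat_left F f a' b
  | gamma_nat_right a f b => exact multAt_nat_right F a f b
  | gamma_nat a a' g =>
    refine Eq.trans ?_ (multAt_nat F a a' g).symm
    exact congrArg (· ≫ multAt F a a' _) (MonoidalCategory.tensorHom_def _ _).symm
  | delta_nat f b b' =>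
    refine Eq.trans ?_ (app_tens (F.map f) b b').symm
    exact congrArg (· ≫ μ (F.obj _).toFunctor b b') (MonoidalCategory.tensorHom_def _ _).symm
  | delta_nat_left a g b' => exact μ_natural_left (F.obj a).toFunctor g b'
  | delta_nat_right a b g => exact μ_natural_right (F.obj a).toFunctor b g
  | delta_assoc a b b' b'' => exact associativity (F.obj a).toFunctor b b' b''
  | delta_left_unit a b => exact left_unitality (F.obj a).toFunctor b
  | delta_right_unit a b => exact right_unitality (F.obj a).toFunctor b
  | delta_braid a b b' => exact Functor.LaxBraided.braided (F := (F.obj a).toFunctor) b b'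
  | gamma_assoc a a' a'' b => exact multAt_assoc F a a' a'' b
  | gamma_left_unit a b => exact multAt_left_unit F a b
  | gamma_right_unit a b => exact multAt_right_unit F a b
  | gamma_braid a a' b => exact multAt_braid F a a' b
  | delta_alpha b b' =>
    refine Eq.trans ?_ (unitAt_tens F b b')
    exact congrArg (· ≫ μ (F.obj (𝟙_ A)).toFunctor b b') (MonoidalCategory.tensorHom_def _ _).symm
  | gamma_beta a a' =>
    refine Eq.trans ?_ (multAt_unit F a a')
    exact congrArg (· ≫ multAt F a a' (𝟙_ B)) (MonoidalCategory.tensorHom_def _ _).symm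
  | beta_alpha => exact (unitAt_unit F).symm
  | gamma_delta a a' b b' =>
    refine Eq.trans ?_ ((multAt_tens F a a' b b').trans ?_)
    · exact congrArg (· ≫ multAt F a a' (b ⊗ b')) (MonoidalCategory.tensorHom_def _ _).symm
    · exact congrArg (tensorμ ((F.obj a).obj b) ((F.obj a).obj b') ((F.obj a').obj b)
          ((F.obj a').obj b') ≫ · ≫ μ (F.obj (a ⊗ a')).toFunctor b b')
        (MonoidalCategory.tensorHom_def _ _)

/-- The strict symmetric monoidal functor `A ⊗ B → C` corresponding to `F : A → [B, C]`. -/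
def En : LaxBraidedFunctor (Tens A B) C := lift (tensorPres A B) (enObj F) (enEdge F) (en_rel F)

end En

end Tensor

/-! ### The unit arrows -/

section Unit

variable (A : Type u) [SmallCategory A] [MonoidalCategory A] [SymmetricCategory A]

/-- The arrow `R : A ⊗ Unc → A` corresponding to the dual `v* : A → [Unc, A]` of `v`. -/
def unitR : LaxBraidedFunctor (Tens A Unc.{u}) A := En (dual (v A))

/-- The arrow `R' : A → A ⊗ Unc`, composite of `η : A → [Unc, A ⊗ Unc]` and of the evaluation at
the generating object of `Unc`. -/
def unitR' : LaxBraidedFunctor A (Tens A Unc.{u}) := compFun (eta A Unc.{u}) (ev _ star)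

end Unit

end SMC

/-! Write ⋆ for `star`. The composite R∘R' sends a to a ⊗ ⋆ and then to v(⋆)(a) = a. All its
structure arrows are identities, because R and `ev` are strict and the generators α_⋆, γ_{a,a',⋆} go
to the structure arrows of v(⋆) = 1_A.

The other composite is harder: R'∘R sends a ⊗ (⋆ ⊗ ⋆) to (a ⊗ a) ⊗ ⋆, and the presentation offers no
direct arrow between the two. Both, however, receive an arrow from (a ⊗ ⋆) ⊗ (a ⊗ ⋆), namely δ and γ
respectively. The functor F of the zigzag turns this into a general recipe: it is strict and sends a
⊗ X to the word X with every ⋆ replaced by a ⊗ ⋆. Formally F = En(K*), where K = `vTens` is the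
strict functor unc → [A, A ⊗ unc] with K(⋆) = R'.

The 2-cells out of F come from two extension principles. (i) `liftHom`: to map a strict functor on a
presented category to a lax functor H, it is enough to give components on the generating objects,
natural on the generating edges. They extend to words through ε and μ of H, and naturality on
canonical arrows follows from the axioms of H (`extend_nat`). Since ε and μ point into H, the strict
functor has to be the source, which is why the comparison is a zigzag out of F. (ii) `enDualHom`: a
2-cell K → [A, H]∘η* yields a 2-cell En(K*) → H, because the edges of the tensor encode exactly what
such a 2-cell satisfies.

Now unc has one generating object and no edges, so by (i) a 2-cell K → [A, H]∘η* only requires an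
arrow R' → H∘η*(⋆) = H∘R'. When H∘R' = R' an identity does the job. This holds for H = 1, and for H
= R'∘R because R∘R' = 1 (`unitR'_comp_unitR`). -/

namespace SMC

/-! ### Equalities of 1-cells, and postcomposition as a 1-cell between internal homs -/

section Functors

variable {A B C : Type u}
  [SmallCategory A] [MonoidalCategory A] [SymmetricCategory A]
  [SmallCategory B] [MonoidalCategory B] [SymmetricCategory B]
  [SmallCategory C] [MonoidalCategory C] [SymmetricCategory C]

/-- Symmetric structures on a functor are equal when their structure arrows are. -/
lemma laxBraided_ext {T : A ⥤ B} (S S' : T.LaxBraided) (hε : S.ε = S'.ε) (hμ : S.μ = S'.μ) :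
    S = S' := by
  obtain ⟨⟩ := S
  obtain ⟨⟩ := S'
  rename_i S _ S' _
  obtain ⟨⟩ := S
  obtain ⟨⟩ := S'
  cases hε
  cases hμ
  rfl

/-- 1-cells with the same underlying functor and the same structure arrows are equal. -/
lemma mk_eq_mk {T : A ⥤ B} {S S' : T.LaxBraided} (hε : S.ε = S'.ε)
    (hμ : ∀ a a', S.μ a a' = S'.μ a a') :
    (@LaxBraidedFunctor.mk A _ _ _ B _ _ _ T S) = @LaxBraidedFunctor.mk A _ _ _ B _ _ _ T S' :=
  congrArg (@LaxBraidedFunctor.mk A _ _ _ B _ _ _ T)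
    (laxBraided_ext S S' hε (funext fun a => funext fun a' => hμ a a'))

/-- The underlying functors agree definitionally here and in the equalities below, so `mk_eq_mk`
applies with a single `T` and only the structure arrows have to be compared. -/
lemma compFun_idFun (F : LaxBraidedFunctor A B) : compFun F (idFun B) = F :=
  mk_eq_mk (T := F.toFunctor) (Category.id_comp _) (fun _ _ => Category.id_comp _)

lemma idFun_compFun (F : LaxBraidedFunctor A B) : compFun (idFun A) F = F :=
  mk_eq_mk (T := F.toFunctor)
    ((congrArg (ε F.toFunctor ≫ ·) (F.map_id _)).trans (Category.comp_id _))
    (fun a a' => (congrArg (μ F.toFunctor a a' ≫ ·) (F.map_id _)).trans (Category.comp_id _))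

lemma compFun_assoc {D : Type u} [SmallCategory D] [MonoidalCategory D] [SymmetricCategory D]
    (F : LaxBraidedFunctor A B) (G : LaxBraidedFunctor B C) (H : LaxBraidedFunctor C D) :
    compFun (compFun F G) H = compFun F (compFun G H) :=
  mk_eq_mk (T := F.toFunctor ⋙ G.toFunctor ⋙ H.toFunctor)
    ((congrArg (ε H.toFunctor ≫ ·) (H.map_comp _ _)).trans (Category.assoc _ _ _).symm)
    (fun _ _ => (congrArg (μ H.toFunctor _ _ ≫ ·) (H.map_comp _ _)).trans
      (Category.assoc _ _ _).symm)

/-- Evaluation is strict: its structure arrows are components of those of an identity 1-cell. What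
remains of the composite's structure is the `b`-component of that of `F`. This is how R' becomes a
value of η*. -/
lemma compFun_ev (F : LaxBraidedFunctor A (LaxBraidedFunctor B C)) (b : B) :
    compFun F (ev C b) = dualObj F b :=
  mk_eq_mk (T := dualObjFunctor F b) (Category.id_comp _) (fun _ _ => Category.id_comp _)

/-- Postcomposition of 2-cells with a 1-cell. -/
def whisker {F F' : LaxBraidedFunctor A B} (σ : F ⟶ F') (G : LaxBraidedFunctor B C) :
    compFun F G ⟶ compFun F' G :=
  mkHom (fun a => G.map (app σ a))
    (fun {a a'} f => by
      change G.map (F.map f) ≫ G.map (app σ a') = G.map (app σ a) ≫ G.map (F'.map f)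
      rw [← G.map_comp, app_nat, G.map_comp])
    (by
      change (ε G.toFunctor ≫ G.map (ε F.toFunctor)) ≫ G.map (app σ (𝟙_ A)) =
        ε G.toFunctor ≫ G.map (ε F'.toFunctor)
      rw [Category.assoc, ← G.map_comp, app_unit])
    (fun a a' => by
      change (μ G.toFunctor (F.obj a) (F.obj a') ≫ G.map (μ F.toFunctor a a')) ≫
          G.map (app σ (a ⊗ a')) =
        (G.map (app σ a) ⊗ₘ G.map (app σ a')) ≫
          μ G.toFunctor (F'.obj a) (F'.obj a') ≫ G.map (μ F'.toFunctor a a')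
      rw [Category.assoc, ← G.map_comp, app_tens, G.map_comp, μ_natural_assoc])

variable (A) in
/-- Postcomposition with a 1-cell, as a 1-cell between the internal homs. -/
def postcomp (G : LaxBraidedFunctor B C) :
    LaxBraidedFunctor (LaxBraidedFunctor A B) (LaxBraidedFunctor A C) where
  toFunctor :=
    { obj := fun F => compFun F G
      map := fun σ => whisker σ G
      map_id := fun F => hom_ext fun a => G.map_id _
      map_comp := fun σ τ => hom_ext fun a => G.map_comp _ _ }
  laxBraided :=
    { ε := mkHom (fun _ => ε G.toFunctor)
        (fun f => ((Category.id_comp _).trans (Category.comp_id _).symm).trans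
          (congrArg (ε G.toFunctor ≫ ·) (G.map_id _).symm))
        ((Category.id_comp _).trans ((Category.comp_id _).symm.trans
          (congrArg (ε G.toFunctor ≫ ·) (G.map_id _).symm)))
        (fun a a' => by
          -- Monoidality of the unit 2-cell is left unitality of `G` at the unit object, combined
          -- with naturality of λ at `ε G`.
          change (λ_ (𝟙_ C)).hom ≫ ε G.toFunctor = (ε G.toFunctor ⊗ₘ ε G.toFunctor) ≫
            μ G.toFunctor (𝟙_ B) (𝟙_ B) ≫ G.map (λ_ (𝟙_ B)).hom
          rw [MonoidalCategory.tensorHom_def', Category.assoc, ← left_unitality,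
            leftUnitor_naturality])
      μ := fun F F' => mkHom (fun a => μ G.toFunctor (F.obj a) (F'.obj a))
        (fun f => (μ_natural G.toFunctor (F.map f) (F'.map f)))
        (by
          change ((λ_ (𝟙_ C)).inv ≫ ((ε G.toFunctor ≫ G.map (ε F.toFunctor)) ⊗ₘ
              (ε G.toFunctor ≫ G.map (ε F'.toFunctor)))) ≫
              μ G.toFunctor (F.obj (𝟙_ A)) (F'.obj (𝟙_ A)) =
            ε G.toFunctor ≫ G.map ((λ_ (𝟙_ B)).inv ≫ (ε F.toFunctor ⊗ₘ ε F'.toFunctor))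
          rw [← tensorHom_comp_tensorHom, Category.assoc, Category.assoc, μ_natural, G.map_comp,
            MonoidalCategory.tensorHom_def', Category.assoc, ← leftUnitor_inv_naturality_assoc,
            left_unitality_inv_assoc])
        (fun a a' => by
          change (tensorμ (G.obj (F.obj a)) (G.obj (F'.obj a)) (G.obj (F.obj a'))
              (G.obj (F'.obj a')) ≫
              ((μ G.toFunctor (F.obj a) (F.obj a') ≫ G.map (μ F.toFunctor a a')) ⊗ₘ
              (μ G.toFunctor (F'.obj a) (F'.obj a') ≫ G.map (μ F'.toFunctor a a')))) ≫
              μ G.toFunctor (F.obj (a ⊗ a')) (F'.obj (a ⊗ a')) =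
            (μ G.toFunctor (F.obj a) (F'.obj a) ⊗ₘ μ G.toFunctor (F.obj a') (F'.obj a')) ≫
              μ G.toFunctor (F.obj a ⊗ F'.obj a) (F.obj a' ⊗ F'.obj a') ≫
              G.map (tensorμ (F.obj a) (F'.obj a) (F.obj a') (F'.obj a') ≫
                (μ F.toFunctor a a' ⊗ₘ μ F'.toFunctor a a'))
          rw [← tensorHom_comp_tensorHom, Category.assoc, Category.assoc, μ_natural, G.map_comp]
          -- The symmetry of `G` enters: a lax functor compatible with the symmetries has a μ
          -- compatible with the middle-four interchange, and this makes μ a monoidal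
          -- transformation.
          have h := congrArg (· ≫ G.map (μ F.toFunctor a a' ⊗ₘ μ F'.toFunctor a a'))
            (tensorμ_comp_μ_tensorHom_μ_comp_μ G.toFunctor
              (F.obj a) (F'.obj a) (F.obj a') (F'.obj a'))
          simp only [Category.assoc] at h
          exact h)
      μ_natural_left := fun {F₁ F₂} σ F => hom_ext fun a => by
        simp only [app_comp, app_whiskerRight]
        -- Whiskering in an internal hom is tensoring with an identity 2-cell, so the whiskered
        -- 2-cell under `G.map` needs its own conversion.
        exact (μ_natural_left G.toFunctor (app σ a) (F.obj a)).trans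
          (congrArg (fun k => μ G.toFunctor (F₁.obj a) (F.obj a) ≫ G.map k)
            (app_whiskerRight σ F a).symm)
      μ_natural_right := fun {F₁ F₂} F σ => hom_ext fun a => by
        simp only [app_comp, app_whiskerLeft]
        exact (μ_natural_right G.toFunctor (F.obj a) (app σ a)).trans
          (congrArg (fun k => μ G.toFunctor (F.obj a) (F₁.obj a) ≫ G.map k)
            (app_whiskerLeft F σ a).symm)
      associativity := fun F F' F'' => hom_ext fun a => by
        simp only [app_comp, app_whiskerLeft, app_whiskerRight]
        exact associativity G.toFunctor (F.obj a) (F'.obj a) (F''.obj a)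
      left_unitality := fun F => hom_ext fun a => by
        simp only [app_comp, app_whiskerRight]
        exact left_unitality G.toFunctor (F.obj a)
      right_unitality := fun F => hom_ext fun a => by
        simp only [app_comp, app_whiskerLeft]
        exact right_unitality G.toFunctor (F.obj a)
      braided := fun F F' => hom_ext fun a =>
        Functor.LaxBraided.braided (F := G.toFunctor) (F.obj a) (F'.obj a) }

end Functors

/-! ### Squares relating canonical arrows to their images under a lax symmetric functor -/

section Pair

variable {D C : Type u}
  [SmallCategory D] [MonoidalCategory D] [SymmetricCategory D]
  [SmallCategory C] [MonoidalCategory C] [SymmetricCategory C]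
  (H : LaxBraidedFunctor D C) {a b c b' : C} {X Y Z Y' : D}

/-- The tensor of two arrows into values of `H`, followed by the structure arrow of `H`. -/
def pair (x : a ⟶ H.obj X) (y : b ⟶ H.obj Y) : a ⊗ b ⟶ H.obj (X ⊗ Y) :=
  (x ⊗ₘ y) ≫ μ H.toFunctor X Y

/-- Naturality of μ carries a commutative square through a whiskering. This lemma and the following
ones are the inductive steps of `extend_nat`, one for each way of forming arrows. -/
lemma pair_whiskerLeft (x : a ⟶ H.obj X) {y : b ⟶ H.obj Y} {y' : b' ⟶ H.obj Y'} {f : b ⟶ b'}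
    {g : Y ⟶ Y'} (h : f ≫ y' = y ≫ H.map g) :
    a ◁ f ≫ pair H x y' = pair H x y ≫ H.map (X ◁ g) := by
  rw [pair, pair, Category.assoc, ← μ_natural_right, ← id_tensorHom,
    tensorHom_comp_tensorHom_assoc, h, ← id_tensorHom, tensorHom_comp_tensorHom_assoc,
    Category.id_comp, Category.comp_id]

lemma pair_whiskerRight (x : a ⟶ H.obj X) {y : b ⟶ H.obj Y} {y' : b' ⟶ H.obj Y'} {f : b ⟶ b'}
    {g : Y ⟶ Y'} (h : f ≫ y' = y ≫ H.map g) :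
    f ▷ a ≫ pair H y' x = pair H y x ≫ H.map (g ▷ X) := by
  rw [pair, pair, Category.assoc, ← μ_natural_left, ← tensorHom_id,
    tensorHom_comp_tensorHom_assoc, h, ← tensorHom_id, tensorHom_comp_tensorHom_assoc,
    Category.id_comp, Category.comp_id]

/-- Each nested pairing is a threefold tensor followed by structure arrows of `H`. The associator
slides past the tensor by naturality and past the structure arrows by the associativity axiom. -/
lemma pair_assoc (x : a ⟶ H.obj X) (y : b ⟶ H.obj Y) (z : c ⟶ H.obj Z) :
    (α_ a b c).hom ≫ pair H x (pair H y z) =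
      pair H (pair H x y) z ≫ H.map (α_ X Y Z).hom := by
  have h₁ : pair H (pair H x y) z =
      ((x ⊗ₘ y) ⊗ₘ z) ≫ μ H.toFunctor X Y ▷ H.obj Z ≫ μ H.toFunctor (X ⊗ Y) Z := by
    rw [← tensorHom_id, tensorHom_comp_tensorHom_assoc, Category.comp_id]
    rfl
  have h₂ : pair H x (pair H y z) =
      (x ⊗ₘ (y ⊗ₘ z)) ≫ H.obj X ◁ μ H.toFunctor Y Z ≫ μ H.toFunctor X (Y ⊗ Z) := by
    rw [← id_tensorHom, tensorHom_comp_tensorHom_assoc, Category.comp_id]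
    rfl
  rw [h₁, h₂, Category.assoc, Category.assoc, associativity, associator_naturality_assoc]

lemma pair_left (x : a ⟶ H.obj X) :
    (λ_ a).hom ≫ x = pair H (ε H.toFunctor) x ≫ H.map (λ_ X).hom := by
  rw [pair, MonoidalCategory.tensorHom_def', Category.assoc, Category.assoc, ← left_unitality,
    leftUnitor_naturality]

lemma pair_right (x : a ⟶ H.obj X) :
    (ρ_ a).hom ≫ x = pair H x (ε H.toFunctor) ≫ H.map (ρ_ X).hom := by
  rw [pair, MonoidalCategory.tensorHom_def, Category.assoc, Category.assoc, ← right_unitality,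
    rightUnitor_naturality]

lemma pair_braid (x : a ⟶ H.obj X) (y : b ⟶ H.obj Y) :
    (β_ a b).hom ≫ pair H y x = pair H x y ≫ H.map (β_ X Y).hom := by
  rw [pair, pair, Category.assoc, Functor.LaxBraided.braided,
    BraidedCategory.braiding_naturality_assoc]

/-- Inverses of the associator and unitors are separate formal arrows; their squares come from
inverting the direct ones. -/
lemma inv_square {u : a ≅ b} {U : X ≅ Y} {x : a ⟶ H.obj X} {y : b ⟶ H.obj Y}
    (h : u.hom ≫ y = x ≫ H.map U.hom) : u.inv ≫ x = y ≫ H.map U.inv := by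
  rw [Iso.inv_comp_eq, ← Category.assoc, h, Category.assoc, ← H.map_comp, Iso.hom_inv_id,
    H.map_id, Category.comp_id]

lemma comp_square {x : a ⟶ H.obj X} {y : b ⟶ H.obj Y} {z : c ⟶ H.obj Z} {f : a ⟶ b} {g : b ⟶ c}
    {k : X ⟶ Y} {l : Y ⟶ Z} (h₁ : f ≫ y = x ≫ H.map k) (h₂ : g ≫ z = y ≫ H.map l) :
    (f ≫ g) ≫ z = x ≫ H.map (k ≫ l) := by
  rw [Category.assoc, h₂, ← Category.assoc, h₁, H.map_comp, Category.assoc]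

end Pair

open Presentation

/-! ### 2-cells from a strict functor on a presented category to a lax functor -/

section LiftHom

variable (P : Presentation.{u}) {C : Type u} [SmallCategory C] [MonoidalCategory C]
  [SymmetricCategory C] {φ : P.Gen → C}
  (H : LaxBraidedFunctor P.Cat C) (s : ∀ g, φ g ⟶ H.obj (Tree.of g))

/-- The extension to all words of a family of arrows indexed by the generating objects. -/
def extend : ∀ X : P.Cat, liftObj φ X ⟶ H.obj X
  | .unit => ε H.toFunctor
  | .of g => s g
  | .tensor X Y => pair H (extend X) (extend Y)

variable (ψ : ∀ X Y, P.Edge X Y → (liftObj φ X ⟶ liftObj φ Y))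

/-- Induction on the formal arrow: `hs` covers the edges, and every other constructor is an axiom of
the category or of the lax symmetric functor `H`. The relations of the presentation impose no
condition, since naturality is tested on one representative at a time. -/
lemma extend_nat
    (hs : ∀ (X Y : Tree P.Gen) (e : P.Edge X Y),
      ψ X Y e ≫ extend P H s Y = extend P H s X ≫ H.map (P.arr (.gen e)))
    {X Y : Tree P.Gen} (f : Formal P.Edge X Y) :
    liftArr φ ψ f ≫ extend P H s Y = extend P H s X ≫ H.map (P.arr f) := by
  induction f with
  | gen e => exact hs _ _ e
  | id X => exact (Category.id_comp _).trans ((Category.comp_id _).symm.trans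
      (congrArg (extend P H s X ≫ ·) (H.map_id (X : P.Cat)).symm))
  | comp f g ihf ihg => exact comp_square H ihf ihg
  | whiskerLeft X f ih => exact pair_whiskerLeft H (extend P H s X) ih
  | whiskerRight f X ih => exact pair_whiskerRight H (extend P H s X) ih
  | assocHom X Y Z => exact pair_assoc H (extend P H s X) (extend P H s Y) (extend P H s Z)
  | assocInv X Y Z =>
    exact inv_square H (pair_assoc H (extend P H s X) (extend P H s Y) (extend P H s Z))
  | leftHom X => exact pair_left H (extend P H s X)
  | leftInv X => exact inv_square H (pair_left H (extend P H s X))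
  | rightHom X => exact pair_right H (extend P H s X)
  | rightInv X => exact inv_square H (pair_right H (extend P H s X))
  | braid X Y => exact pair_braid H (extend P H s X) (extend P H s Y)

variable (hψ : ∀ (X Y : Tree P.Gen) (f g : Formal P.Edge X Y), P.Rel X Y f g →
      liftArr φ ψ f = liftArr φ ψ g)

/-- A 2-cell out of a strict functor determined by its components at the generating objects. -/
def liftHom (hs : ∀ (X Y : Tree P.Gen) (e : P.Edge X Y),
      ψ X Y e ≫ extend P H s Y = extend P H s X ≫ H.map (P.arr (.gen e))) :
    lift P φ ψ hψ ⟶ H :=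
  mkHom (extend P H s)
    (by
      rintro X Y ⟨f⟩
      exact extend_nat P H s ψ hs f)
    -- Both monoidality conditions hold by construction: the strict functor has identity structure
    -- arrows, and `extend` is defined by ε and μ of `H` on the unit and on tensors.
    (Category.id_comp _)
    (fun _ _ => Category.id_comp _)

end LiftHom

/-! ### 2-cells out of a strict functor on the tensor -/

section EnHom

variable {A B C : Type u}
  [SmallCategory A] [MonoidalCategory A] [SymmetricCategory A]
  [SmallCategory B] [MonoidalCategory B] [SymmetricCategory B]
  [SmallCategory C] [MonoidalCategory C] [SymmetricCategory C]
  {K : LaxBraidedFunctor B (LaxBraidedFunctor A C)} {H : LaxBraidedFunctor (Tens A B) C}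

/-- The 2-cell `En K* → H` corresponding to a 2-cell `K → [A, H] ∘ η*`. -/
def enDualHom (κ : K ⟶ compFun (dual (eta A B)) (postcomp A H)) : En (dual K) ⟶ H :=
  liftHom (tensorPres A B) H (fun p => app (app κ p.2) p.1) _ _ <| by
    intro X Y e
    -- Passing to the dual exchanges the two variables. The edges α, γ, f ⊗ b express that each
    -- component of `κ` is a monoidal natural transformation in the first variable; β, δ, a ⊗ g
    -- express that `κ` itself is one in the second.
    cases e with
    | alpha b => exact app_unit (app κ b)
    | beta a => exact congrArg (fun σ => app σ a) (app_unit κ)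
    | gamma a a' b =>
      exact (app_tens (app κ b) a a').trans (Category.assoc _ _ _).symm
    | delta a b b' =>
      exact (congrArg (fun σ => app σ a) (app_tens κ b b')).trans (Category.assoc _ _ _).symm
    | mapLeft f b => exact app_nat (app κ b) f
    | mapRight a g => exact congrArg (fun σ => app σ a) (app_nat κ g)

end EnHom

/-! ### The zigzag between the identity and R'∘R -/

section Unit

variable (A : Type u) [SmallCategory A] [MonoidalCategory A] [SymmetricCategory A]

/-- The underlying functor is definitionally the identity, as a ⊗ ⋆ goes to v(⋆)(a) = a; the content
lies in the structure arrows. -/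
lemma unitR'_comp_unitR : compFun (unitR' A) (unitR A) = idFun A := by
  refine mk_eq_mk (T := 𝟭 A) ?_ (fun a a' => ?_)
  -- The factors are the unit arrow of the strict R, the image under R of that of the strict `ev`,
  -- and R(α_⋆), which is the unit arrow of v(⋆) = 1_A.
  · change 𝟙 (𝟙_ A) ≫ (𝟙 (𝟙_ A) ≫ 𝟙 (𝟙_ A)) = 𝟙 (𝟙_ A)
    simp only [Category.comp_id]
  -- Likewise, with R(γ_{a,a',⋆}) as last factor, the tensor structure arrow of 1_A.
  · change 𝟙 (a ⊗ a') ≫ (𝟙 (a ⊗ a') ≫ 𝟙 (a ⊗ a')) = 𝟙 (a ⊗ a')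
    simp only [Category.comp_id]

/-- R' is η*(⋆), so [A, H]∘η* takes the value H∘R' at ⋆. -/
lemma unitR'_eq : unitR' A = dualObj (eta A Unc.{u}) star := compFun_ev _ _

/-- This makes H = R'∘R satisfy H∘R' = R', the hypothesis of `enVTensHom`. -/
lemma unitR'_comp_unitR_comp_unitR' :
    compFun (unitR' A) (compFun (unitR A) (unitR' A)) = unitR' A := by
  rw [← compFun_assoc, unitR'_comp_unitR, idFun_compFun]

/-- The strict functor `Unc → [A, A ⊗ Unc]` sending the generating object to `R'`. -/
def vTens : LaxBraidedFunctor Unc.{u} (LaxBraidedFunctor A (Tens A Unc.{u})) :=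
  lift uncPres.{u} (fun _ => unitR' A) (fun _ _ e => e.elim) (fun _ _ _ _ h => h.elim)

variable {A} in
/-- The 2-cell `En(vTens*) → H` determined by its components at the objects `a ⊗ star`. -/
def enVTensHom {H : LaxBraidedFunctor (Tens A Unc.{u}) (Tens A Unc.{u})}
    (h : unitR' A = compFun (unitR' A) H) : En (dual (vTens A)) ⟶ H :=
  enDualHom (liftHom uncPres.{u} _
    -- The component at ⋆ is the equality R' = H∘R' = H∘η*(⋆) read as a 2-cell. Naturality on edges
    -- is vacuous because unc has no generating edge.
    (fun _ => eqToHom (h.trans (congrArg (compFun · H) (unitR'_eq A)))) _ _ (fun _ _ e => e.elim))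

end Unit

end SMC

theorem mainTheorem11 (A : Type u) [SmallCategory A] [MonoidalCategory A] [SymmetricCategory A] :
    SMC.compFun (SMC.unitR' A) (SMC.unitR A) = SMC.idFun A ∧
    ∃ F : LaxBraidedFunctor (SMC.Tens A SMC.Unc.{u}) (SMC.Tens A SMC.Unc.{u}),
      Nonempty (F ⟶ SMC.idFun (SMC.Tens A SMC.Unc.{u})) ∧
      Nonempty (F ⟶ SMC.compFun (SMC.unitR A) (SMC.unitR' A)) :=
  ⟨SMC.unitR'_comp_unitR A, SMC.En (SMC.dual (SMC.vTens A)),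
    -- Both legs are the same construction, at H = 1 and at H = R'∘R. On a ⊗ (⋆ ⊗ ⋆) they give
    -- δ_{a,⋆,⋆} and γ_{a,a,⋆}.
    ⟨SMC.enVTensHom (SMC.compFun_idFun _).symm⟩, ⟨SMC.enVTensHom (SMC.unitR'_comp_unitR_comp_unitR' A).symm⟩⟩
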